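/- Fix a relational schema (relation names of positive arity whose attributes are typed over two disjoint domains: uninterpreted constants $D$ and the rationals $\mathbb{Q}$) and a set $F$ of denial constraints, i.e. sentences $\forall\bar x.\,\neg[R_1(\bar x_1)\wedge\dots\wedge R_n(\bar x_n)\wedge\varphi(\bar x)]$ with $n>0$, $\bar x=\bar x_1\cup\dots\cup\bar x_n$, and $\varphi$ a well-typed quantifier-free formula over the built-in relations $=,\neq$ (on both domains) and $<,\le,>,\ge$ (on $\mathbb{Q}$). An instance $I$ is a finite set of facts. A set $C\subseteq I$ is a conflict if $C=\{R_1(\rho(\bar x_1)),\dots,R_n(\rho(\bar x_n))\}$ for some constraint in $F$ as above and some substitution $\rho$ of constants for variables making $\varphi$ true; two facts are neighbors if some conflict contains both. A repair of $I$ is a maximal subset of $I$ consistent with $F$. A priority $\succ$ is an acyclic binary relation on $I$ that relates only neighbors; it is total if no other priority extends it. A set $I'\subseteq I$ is globally optimal w.r.t. $\succ$ if there are no nonempty $X\subseteq I'$ and $Y\subseteq I\setminus I'$ such that every $x\in X$ has some $y\in Y$ with $y\succ x$ and $(I'\setminus X)\cup Y$ is consistent with $F$. A common optimal repair of $I$ w.r.t.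 $\succ$ is a repair of $I$ that is globally optimal w.r.t. some total priority extending $\succ$. For $A\subseteq I$ let $\omega_\succ(A)=\{x\in A:\nexists y\in A.\ y\succ x\}$. Consider the following nondeterministic algorithm. Start with $I^o=I$ and $J=\varnothing$. While $\omega_\succ(I^o)\neq\varnothing$: choose any $x\in\omega_\succ(I^o)$, remove $x$ from $I^o$, and, if $J\cup\{x\}$ is consistent with $F$, add $x$ to $J$. Finally return $J$. Theorem. For every instance $I$ and every priority $\succ$ of $I$ w.r.t. $F$: (1) the set of possible outputs of the algorithm on $(I,\succ)$ is exactly the set of common optimal repairs of $I$ w.r.t. $F$ and $\succ$ (soundness and completeness); (2) every run of the algorithm terminates after at most $|I|$ iterations; and, for each fixed finite $F$, the algorithm works in time polynomial in the size of $I$ and $\succ$: there are a nondeterministic program $P$ (a while-program over lists, in which relation names and constants are atomic and the built-in relations are primitive tests) and a polynomial $p$, both depending only on the schema and $F$, such that for every encoding of $(I,\succ)$ of size $N$ as a list of the facts of $I$ and a list of the pairs $x\succ y$, every run of $P$ halts within $p(N)$ elementary steps, and the halting runs of $P$ return exactly the complete executions of the algorithm on $(I,\succ)$, each reported as its sequence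 of choices together with its output $J$. -/

import Mathlib

namespace PrefRepair

universe u v

/-! ### Relational databases and denial constraints -/

/-- The two types of attributes: uninterpreted names and rational numbers. -/
inductive Kind where
  | name
  | num

/-- Constants: the elements of the disjoint domains `D` (uninterpreted) and `ℚ`. -/
inductive Const (D : Type u) where
  | name (d : D)
  | num (q : ℚ)

def Const.kind {D : Type u} : Const D → Kind
  | .name _ => .name
  | .num _ => .num

/-- A schema on a set of relation names: each relation name has a positive arity and a type for
each of its attributes, given by the list `type R`. -/
structure Schema (Rel : Type v) where
  type : Rel → List Kind
  arity_pos : ∀ R, 0 < (type R).length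

/-- A fact `R(t)`, with `t` a tuple of constants of the right types. -/
structure DBFact (D : Type u) {Rel : Type v} (S : Schema Rel) where
  rel : Rel
  args : List (Const D)
  typed : args.map Const.kind = S.type rel

/-- Typed variables. -/
structure Var where
  kind : Kind
  idx : ℕ

/-- A relational atom `R(x̄)`, with `x̄` a tuple of variables of the right types. -/
structure RelAtom {Rel : Type v} (S : Schema Rel) where
  rel : Rel
  vars : List Var
  typed : vars.map Var.kind = S.type rel

inductive Term (D : Type u) where
  | var (x : Var)
  | const (c : Const D)

/-- The built-in relation symbols `=, ≠, <, ≤, >, ≥`. -/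
inductive Cmp where
  | eq
  | ne
  | lt
  | le
  | gt
  | ge

def Cmp.IsOrder : Cmp → Prop
  | .eq => False
  | .ne => False
  | .lt => True
  | .le => True
  | .gt => True
  | .ge => True

/-- Interpretation of the built-in relations. The order symbols are interpreted over `ℚ` only. -/
def Cmp.Holds {D : Type u} : Cmp → Const D → Const D → Prop
  | .eq, a, b => a = b
  | .ne, a, b => a ≠ b
  | .lt, .num p, .num q => p < q
  | .le, .num p, .num q => p ≤ q
  | .gt, .num p, .num q => p > q
  | .ge, .num p, .num q => p ≥ q
  | _, _, _ => False

/-- Quantifier-free formulas over the built-in relations. -/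
inductive Formula (D : Type u) where
  | tru
  | cmp (op : Cmp) (s t : Term D)
  | not (φ : Formula D)
  | and (φ ψ : Formula D)
  | or (φ ψ : Formula D)

def Term.kind {D : Type u} : Term D → Kind
  | .var x => x.kind
  | .const c => c.kind

def Term.HasVar {D : Type u} (x : Var) : Term D → Prop
  | .var y => x = y
  | .const _ => False

def Term.eval {D : Type u} (ρ : Var → Const D) : Term D → Const D
  | .var x => ρ x
  | .const c => c

/-- The variable `x` occurs in the formula. -/
def Formula.HasVar {D : Type u} (x : Var) : Formula D → Prop
  | .tru => False
  | .cmp _ s t => s.HasVar x ∨ t.HasVar x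
  | .not φ => φ.HasVar x
  | .and φ ψ => φ.HasVar x ∨ ψ.HasVar x
  | .or φ ψ => φ.HasVar x ∨ ψ.HasVar x

/-- Only terms of the same type are compared, and the order symbols are used on `ℚ` only. -/
def Formula.WellTyped {D : Type u} : Formula D → Prop
  | .tru => True
  | .cmp op s t => s.kind = t.kind ∧ (op.IsOrder → s.kind = .num)
  | .not φ => φ.WellTyped
  | .and φ ψ => φ.WellTyped ∧ ψ.WellTyped
  | .or φ ψ => φ.WellTyped ∧ ψ.WellTyped

def Formula.Holds {D : Type u} (ρ : Var → Const D) : Formula D → Prop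
  | .tru => True
  | .cmp op s t => op.Holds (s.eval ρ) (t.eval ρ)
  | .not φ => ¬ φ.Holds ρ
  | .and φ ψ => φ.Holds ρ ∧ ψ.Holds ρ
  | .or φ ψ => φ.Holds ρ ∨ ψ.Holds ρ

/-- The denial constraint `∀ x̄. ¬ [R₁(x̄₁) ∧ … ∧ Rₙ(x̄ₙ) ∧ φ(x̄)]` with `n > 0`, where each variable
of `φ` occurs in some `x̄ᵢ`. -/
structure DenialConstraint (D : Type u) {Rel : Type v} (S : Schema Rel) where
  atoms : List (RelAtom S)
  atoms_ne : atoms ≠ []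
  cond : Formula D
  typed : cond.WellTyped
  safe : ∀ x, cond.HasVar x → ∃ a ∈ atoms, x ∈ a.vars

section Repairs

variable {D : Type u} {Rel : Type v} {S : Schema Rel}

/-- `f` is the ground instance of the atom `a` under the substitution `ρ`. As atoms and facts are
typed, `ρ` then respects the types of the variables of `a`. -/
def RelAtom.Matches (ρ : Var → Const D) (a : RelAtom S) (f : DBFact D S) : Prop :=
  f.rel = a.rel ∧ f.args = a.vars.map ρ

/-- `J ⊨ c`. -/
def DenialConstraint.Sat (c : DenialConstraint D S) (J : Set (DBFact D S)) : Prop :=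
  ∀ ρ : Var → Const D, ¬ ((∀ a ∈ c.atoms, ∃ f ∈ J, a.Matches ρ f) ∧ c.cond.Holds ρ)

/-- `J ⊨ F`. -/
def Consistent (F : Set (DenialConstraint D S)) (J : Set (DBFact D S)) : Prop :=
  ∀ c ∈ F, c.Sat J

/-- `I'` is a repair of `I`: a maximal consistent subset. -/
def IsRepair (I : Set (DBFact D S)) (F : Set (DenialConstraint D S)) (I' : Set (DBFact D S)) : Prop :=
  Maximal (fun J => J ⊆ I ∧ Consistent F J) I'

/-- `C` is a conflict in `I`: the set of ground instances, all of them in `I`, of the atoms of some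
constraint under a substitution that makes its condition true. -/
def IsConflict (I : Set (DBFact D S)) (F : Set (DenialConstraint D S)) (C : Set (DBFact D S)) : Prop :=
  C ⊆ I ∧ ∃ c ∈ F, ∃ ρ : Var → Const D, c.cond.Holds ρ ∧
    (∀ a ∈ c.atoms, ∃ f ∈ C, a.Matches ρ f) ∧ (∀ f ∈ C, ∃ a ∈ c.atoms, a.Matches ρ f)

def Neighbors (I : Set (DBFact D S)) (F : Set (DenialConstraint D S)) (x y : DBFact D S) : Prop :=
  ∃ C, IsConflict I F C ∧ x ∈ C ∧ y ∈ C

/-- A priority: an acyclic relation (`r x y` reads `x ≻ y`) between neighboring facts of `I`. -/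
structure IsPriority (I : Set (DBFact D S)) (F : Set (DenialConstraint D S))
    (r : DBFact D S → DBFact D S → Prop) : Prop where
  acyclic : ∀ x, ¬ Relation.TransGen r x x
  neighbors : ∀ x y, r x y → Neighbors I F x y

/-- `r'` is an extension of `r`. -/
def Extends (r' r : DBFact D S → DBFact D S → Prop) : Prop :=
  ∀ x y, r x y → r' x y

/-- A total priority: one with no extension other than itself. -/
def IsTotalPriority (I : Set (DBFact D S)) (F : Set (DenialConstraint D S))
    (r : DBFact D S → DBFact D S → Prop) : Prop :=
  IsPriority I F r ∧ ∀ r', IsPriority I F r' → Extends r' r → r' = r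

def GloballyOptimal (I : Set (DBFact D S)) (F : Set (DenialConstraint D S))
    (r : DBFact D S → DBFact D S → Prop) (I' : Set (DBFact D S)) : Prop :=
  I' ⊆ I ∧ ∀ X Y : Set (DBFact D S), X ⊆ I' → X.Nonempty → Y ⊆ I \ I' →
    (∀ x ∈ X, ∃ y ∈ Y, r y x) → ¬ Consistent F ((I' \ X) ∪ Y)

def CommonOptimal (I : Set (DBFact D S)) (F : Set (DenialConstraint D S))
    (r : DBFact D S → DBFact D S → Prop) (I' : Set (DBFact D S)) : Prop :=
  ∃ r', IsTotalPriority I F r' ∧ Extends r' r ∧ GloballyOptimal I F r' I'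

/-- The set of common optimal repairs of `I`. -/
def CRep (I : Set (DBFact D S)) (F : Set (DenialConstraint D S))
    (r : DBFact D S → DBFact D S → Prop) : Set (Set (DBFact D S)) :=
  {I' | IsRepair I F I' ∧ CommonOptimal I F r I'}

/-! ### The greedy algorithm -/

/-- The winnow operator: the undominated elements of `A`. -/
def winnow (r : DBFact D S → DBFact D S → Prop) (A : Set (DBFact D S)) : Set (DBFact D S) :=
  {x ∈ A | ¬ ∃ y ∈ A, r y x}

/-- `Run F r A J xs A' J'`: from the state with remaining facts `A` and current instance `J`, the
main loop reaches the state `(A', J')` by making the sequence of choices `xs`, one per iteration. -/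
inductive Run (F : Set (DenialConstraint D S)) (r : DBFact D S → DBFact D S → Prop) :
    Set (DBFact D S) → Set (DBFact D S) → List (DBFact D S) → Set (DBFact D S) → Set (DBFact D S) → Prop
  | refl (A J) : Run F r A J [] A J
  | add {A J xs A' J'} (x : DBFact D S) (hx : x ∈ winnow r A) (hc : Consistent F (insert x J))
      (h : Run F r (A \ {x}) (insert x J) xs A' J') : Run F r A J (x :: xs) A' J'
  | discard {A J xs A' J'} (x : DBFact D S) (hx : x ∈ winnow r A)
      (hc : ¬ Consistent F (insert x J))
      (h : Run F r (A \ {x}) J xs A' J') : Run F r A J (x :: xs) A' J'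

/-- A complete execution on `I` with the sequence of choices `xs`, returning `J`: the loop is left
when the winnow of the remaining facts is empty. -/
def Execution (I : Set (DBFact D S)) (F : Set (DenialConstraint D S))
    (r : DBFact D S → DBFact D S → Prop) (xs : List (DBFact D S)) (J : Set (DBFact D S)) : Prop :=
  ∃ A, Run F r I ∅ xs A J ∧ winnow r A = ∅

end Repairs

/-! ### A machine model with a step count

Nondeterministic while-programs over S-expressions. The atoms are relation names and constants;
the built-in relations on constants are primitive tests. -/

inductive Val (D : Type u) (Rel : Type v) where
  | nil
  | rel (R : Rel)
  | const (c : Const D)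
  | cons (a b : Val D Rel)

/-- Expressions; registers are numbered. -/
inductive Expr (D : Type u) (Rel : Type v) where
  | reg (n : ℕ)
  | nil
  | rel (R : Rel)
  | const (c : Const D)
  | cons (e₁ e₂ : Expr D Rel)
  | hd (e : Expr D Rel)
  | tl (e : Expr D Rel)

inductive Test (D : Type u) (Rel : Type v) where
  | isNil (e : Expr D Rel)
  | same (e₁ e₂ : Expr D Rel)
  | cmp (op : Cmp) (e₁ e₂ : Expr D Rel)
  | not (b : Test D Rel)
  | and (b₁ b₂ : Test D Rel)
  | or (b₁ b₂ : Test D Rel)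

inductive Cmd (D : Type u) (Rel : Type v) where
  | skip
  | assign (n : ℕ) (e : Expr D Rel)
  | seq (c₁ c₂ : Cmd D Rel)
  | ite (b : Test D Rel) (c₁ c₂ : Cmd D Rel)
  | loop (b : Test D Rel) (c : Cmd D Rel)
  | choose (c₁ c₂ : Cmd D Rel)

section Machine

variable {D : Type u} {Rel : Type v}

/-- The number of cells of an S-expression. -/
def Val.size : Val D Rel → ℕ
  | .nil => 1
  | .rel _ => 1
  | .const _ => 1
  | .cons a b => a.size + b.size + 1

def Val.hd : Val D Rel → Val D Rel
  | .cons a _ => a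
  | _ => .nil

def Val.tl : Val D Rel → Val D Rel
  | .cons _ b => b
  | _ => .nil

def Val.ofList : List (Val D Rel) → Val D Rel
  | [] => .nil
  | a :: l => .cons a (Val.ofList l)

def Expr.eval (σ : ℕ → Val D Rel) : Expr D Rel → Val D Rel
  | .reg n => σ n
  | .nil => .nil
  | .rel R => .rel R
  | .const c => .const c
  | .cons e₁ e₂ => .cons (e₁.eval σ) (e₂.eval σ)
  | .hd e => (e.eval σ).hd
  | .tl e => (e.eval σ).tl

/-- Each operation of an expression takes one unit of time. -/
def Expr.cost : Expr D Rel → ℕ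
  | .reg _ => 1
  | .nil => 1
  | .rel _ => 1
  | .const _ => 1
  | .cons e₁ e₂ => e₁.cost + e₂.cost + 1
  | .hd e => e.cost + 1
  | .tl e => e.cost + 1

def Test.Holds (σ : ℕ → Val D Rel) : Test D Rel → Prop
  | .isNil e => e.eval σ = .nil
  | .same e₁ e₂ => e₁.eval σ = e₂.eval σ
  | .cmp op e₁ e₂ => ∃ a b, e₁.eval σ = .const a ∧ e₂.eval σ = .const b ∧ op.Holds a b
  | .not b => ¬ b.Holds σ
  | .and b₁ b₂ => b₁.Holds σ ∧ b₂.Holds σ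
  | .or b₁ b₂ => b₁.Holds σ ∨ b₂.Holds σ

/-- Each operation of a test takes one unit of time, except that comparing two S-expressions
takes time proportional to their sizes. -/
def Test.cost (σ : ℕ → Val D Rel) : Test D Rel → ℕ
  | .isNil e => e.cost + 1
  | .same e₁ e₂ => e₁.cost + e₂.cost + (e₁.eval σ).size + (e₂.eval σ).size + 1
  | .cmp _ e₁ e₂ => e₁.cost + e₂.cost + 1
  | .not b => b.cost σ + 1
  | .and b₁ b₂ => b₁.cost σ + b₂.cost σ + 1
  | .or b₁ b₂ => b₁.cost σ + b₂.cost σ + 1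

/-- A configuration: the stack of commands still to be executed, and the registers. The machine
halts when the stack is empty. -/
abbrev Config (D : Type u) (Rel : Type v) := List (Cmd D Rel) × (ℕ → Val D Rel)

/-- `Step c t c'`: the machine can pass from `c` to `c'` in one transition, which takes time `t`. -/
inductive Step : Config D Rel → ℕ → Config D Rel → Prop
  | skip (K σ) : Step (.skip :: K, σ) 1 (K, σ)
  | assign (n e K σ) :
      Step (.assign n e :: K, σ) (e.cost + 1) (K, Function.update σ n (e.eval σ))
  | seq (c₁ c₂ K σ) : Step (.seq c₁ c₂ :: K, σ) 1 (c₁ :: c₂ :: K, σ)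
  | ite_true (b c₁ c₂ K σ) (h : b.Holds σ) :
      Step (.ite b c₁ c₂ :: K, σ) (b.cost σ + 1) (c₁ :: K, σ)
  | ite_false (b c₁ c₂ K σ) (h : ¬ b.Holds σ) :
      Step (.ite b c₁ c₂ :: K, σ) (b.cost σ + 1) (c₂ :: K, σ)
  | loop_true (b c K σ) (h : b.Holds σ) :
      Step (.loop b c :: K, σ) (b.cost σ + 1) (c :: .loop b c :: K, σ)
  | loop_false (b c K σ) (h : ¬ b.Holds σ) :
      Step (.loop b c :: K, σ) (b.cost σ + 1) (K, σ)
  | choose_left (c₁ c₂ K σ) : Step (.choose c₁ c₂ :: K, σ) 1 (c₁ :: K, σ)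
  | choose_right (c₁ c₂ K σ) : Step (.choose c₁ c₂ :: K, σ) 1 (c₂ :: K, σ)

/-- `Reaches c t c'`: the machine can pass from `c` to `c'` in total time `t`. -/
inductive Reaches : Config D Rel → ℕ → Config D Rel → Prop
  | refl (c) : Reaches c 0 c
  | step {c t c' t' c''} (h : Step c t c') (h' : Reaches c' t' c'') : Reaches c (t + t') c''

/-- The program `P` started with `input` in register `0` and all the other registers empty. -/
def initial (P : Cmd D Rel) (input : Val D Rel) : Config D Rel :=
  ([P], Function.update (fun _ => .nil) 0 input)

/-- Some run of `P` on `input` halts with `output` in register `0`. -/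
def Returns (P : Cmd D Rel) (input output : Val D Rel) : Prop :=
  ∃ t σ, Reaches (initial P input) t ([], σ) ∧ σ 0 = output

/-- Every run of `P` on `input`, whatever choices it makes, halts within time `T` (each transition
takes positive time, and only configurations with an empty stack have no transition). -/
def HaltsWithin (P : Cmd D Rel) (input : Val D Rel) (T : ℕ) : Prop :=
  ∀ t c, Reaches (initial P input) t c → t ≤ T

variable {S : Schema Rel}

/-- The S-expression `(R t₁ … tₖ)`. -/
def DBFact.encode (f : DBFact D S) : Val D Rel :=
  .cons (.rel f.rel) (.ofList (f.args.map .const))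

def encodeFacts (l : List (DBFact D S)) : Val D Rel :=
  .ofList (l.map DBFact.encode)

def encodePairs (l : List (DBFact D S × DBFact D S)) : Val D Rel :=
  .ofList (l.map fun p => .cons p.1.encode p.2.encode)

/-- The list `l` enumerates the set `A` without repetition. -/
def Lists {α : Type*} (l : List α) (A : Set α) : Prop :=
  l.Nodup ∧ ∀ x, x ∈ l ↔ x ∈ A

/-- `v` is an encoding of the instance `I` together with the priority `r`: a list of the facts of
`I` and a list of the pairs `(x, y)` with `x ≻ y`. -/
def EncodesInput (v : Val D Rel) (I : Set (DBFact D S)) (r : DBFact D S → DBFact D S → Prop) : Prop :=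
  ∃ lI lr, Lists lI I ∧ Lists lr {p : DBFact D S × DBFact D S | r p.1 p.2} ∧
    v = .cons (encodeFacts lI) (encodePairs lr)

/-- `v` is an encoding of the sequence of choices `xs` together with the instance `J`. -/
def EncodesOutput (v : Val D Rel) (xs : List (DBFact D S)) (J : Set (DBFact D S)) : Prop :=
  ∃ lJ, Lists lJ J ∧ v = .cons (encodeFacts xs) (encodeFacts lJ)

/-- `P` implements the greedy algorithm for the constraints `F`: on each input its halting runs
return exactly the complete executions of the algorithm, each being reported as its sequence of
choices and its result. -/
def Implements (P : Cmd D Rel) (F : Set (DenialConstraint D S)) : Prop :=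
  ∀ (I : Set (DBFact D S)) (r : DBFact D S → DBFact D S → Prop) (input : Val D Rel),
    I.Finite → IsPriority I F r → EncodesInput input I r →
      (∀ out, Returns P input out → ∃ xs J, Execution I F r xs J ∧ EncodesOutput out xs J) ∧
      (∀ xs J, Execution I F r xs J → ∃ out, Returns P input out ∧ EncodesOutput out xs J)

/-- On each input of size `n`, every run of `P` halts within time `p(n)`, for a polynomial `p`. -/
def PolyTime (P : Cmd D Rel) (F : Set (DenialConstraint D S)) : Prop :=
  ∃ p : Polynomial ℕ, ∀ (I : Set (DBFact D S)) (r : DBFact D S → DBFact D S → Prop) (input : Val D Rel),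
    I.Finite → IsPriority I F r → EncodesInput input I r →
      HaltsWithin P input (p.eval input.size)

end Machine

end PrefRepair

open PrefRepair

namespace PrefRepair

universe u v

/-! ### Conflicts and consistency -/

section Greedy

variable {D : Type u} {Rel : Type v} {S : Schema Rel}
  {F : Set (DenialConstraint D S)} {r r' : DBFact D S → DBFact D S → Prop}
  {I A A' J J' C : Set (DBFact D S)} {xs : List (DBFact D S)}

/-! An execution that exhausts `I` lists its facts in an order compatible with `r`. Its output `J`
is therefore described by an injective rank `k` respecting `r`: a fact belongs to `J` exactly when
it is consistent with the members of `J` of smaller rank (`GreedyFor`, extracted by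
`Run.exists_rank`). Induction on the rank shows that `k` determines `J`.

Soundness: orienting all neighbors by `k` gives a total priority extending `r`. An improving
exchange of `X` for `Y` would leave untouched every kept fact ranked before the first element of
`Y`, so that element would have been kept.

Completeness: let `J` be a repair that is globally optimal for a total priority `r'` extending `r`,
and take the rank of some greedy run for `r'`. If `J` missed a fact `x` consistent with its members
of smaller rank, one could add `x` and delete the members dominated by `x`. The result is
consistent, because in any conflict with `x` the other facts are comparable to `x`. This contradicts
maximality or optimality. Hence `J` is greedy for that rank and equals the output of the run, which
is also a run for `r`.

Each iteration removes a fact, which bounds the number of iterations. For the running time, the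
constraints are fixed, so testing one is a fixed nesting of loops over the kept facts. The program
logic `Ensures` has two modes sharing one proof: `m = false` gives halting, time and correctness of
all runs, and `m = true` gives a run reporting any prescribed execution (`ensures_greedyCmd`). -/

theorem DBFact.eq_of_rel_args {f g : DBFact D S} (h : f.rel = g.rel) (h' : f.args = g.args) :
    f = g := by
  cases f; cases g; simp_all

theorem RelAtom.Matches.unique {ρ : Var → Const D} {a : RelAtom S} {f g : DBFact D S}
    (hf : a.Matches ρ f) (hg : a.Matches ρ g) : f = g :=
  DBFact.eq_of_rel_args (hf.1.trans hg.1.symm) (hf.2.trans hg.2.symm)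

theorem Consistent.mono (h : Consistent F J) (hs : J' ⊆ J) : Consistent F J' := by
  rintro c hc ρ ⟨h1, h2⟩
  refine h c hc ρ ⟨fun a ha => ?_, h2⟩
  obtain ⟨f, hf, hm⟩ := h1 a ha
  exact ⟨f, hs hf, hm⟩

theorem consistent_empty : Consistent F (∅ : Set (DBFact D S)) := by
  rintro c - ρ ⟨h1, -⟩
  obtain ⟨a, ha⟩ := List.exists_mem_of_ne_nil _ c.atoms_ne
  obtain ⟨f, hf, -⟩ := h1 a ha
  exact hf

/-- The instances of the atoms under a violating substitution form the conflict; it lies in `J`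
because an atom has only one instance under a given substitution. -/
theorem exists_conflict (h : ¬ Consistent F J) : ∃ C, IsConflict J F C := by
  simp only [Consistent, DenialConstraint.Sat, not_forall, not_not] at h
  obtain ⟨c, hc, ρ, h1, h2⟩ := h
  refine ⟨{f | ∃ a ∈ c.atoms, a.Matches ρ f}, ?_, c, hc, ρ, h2, ?_, fun f hf => hf⟩
  · rintro f ⟨a, ha, hm⟩
    obtain ⟨g, hg, hm'⟩ := h1 a ha
    rwa [hm.unique hm']
  · intro a ha
    obtain ⟨g, hg, hm'⟩ := h1 a ha
    exact ⟨g, ⟨a, ha, hm'⟩, hm'⟩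

theorem IsConflict.not_consistent (h : IsConflict I F C) (hs : C ⊆ J) : ¬ Consistent F J := by
  obtain ⟨-, c, hc, ρ, h1, h2, -⟩ := h
  exact fun hJ => hJ.mono hs c hc ρ ⟨h2, h1⟩

theorem IsConflict.mono (h : IsConflict I F C) (hs : I ⊆ J) : IsConflict J F C :=
  ⟨h.1.trans hs, h.2⟩

theorem Neighbors.symm {x y : DBFact D S} (h : Neighbors I F x y) : Neighbors I F y x :=
  let ⟨C, h1, h2, h3⟩ := h
  ⟨C, h1, h3, h2⟩

theorem Neighbors.mem_left {x y : DBFact D S} (h : Neighbors I F x y) : x ∈ I :=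
  let ⟨_, h1, h2, _⟩ := h
  h1.1 h2

/-! ### Total priorities -/

/-- By maximality, a pair of distinct neighbors can be missing from `r` only if adding it closes a
cycle, that is, if a path leads back. Were both orientations missing, the two paths would form a
cycle in `r`. -/
theorem IsTotalPriority.comparable (h : IsTotalPriority I F r) {x y : DBFact D S}
    (hn : Neighbors I F x y) (hne : x ≠ y) : r x y ∨ r y x := by
  by_contra! hcon
  have key : ∀ a b : DBFact D S, Neighbors I F a b → ¬ r a b → a ≠ b →
      Relation.TransGen r b a := by
    intro a b hab hr hne
    by_contra hpath
    let r₁ : DBFact D S → DBFact D S → Prop := fun u v => r u v ∨ (u = a ∧ v = b)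
    -- A path using the new edge can be cut at its first and last use of it.
    have hgen : ∀ u v, Relation.TransGen r₁ u v → Relation.TransGen r u v ∨
        (Relation.ReflTransGen r u a ∧ Relation.ReflTransGen r b v) := by
      intro u v huv
      induction huv with
      | single h' =>
        rcases h' with h' | ⟨rfl, rfl⟩
        · exact .inl (.single h')
        · exact .inr ⟨.refl, .refl⟩
      | tail _ h' ih =>
        rcases h' with h' | ⟨rfl, rfl⟩
        · rcases ih with ih | ⟨ih1, ih2⟩
          · exact .inl (ih.tail h')
          · exact .inr ⟨ih1, ih2.tail h'⟩
        · rcases ih with ih | ⟨ih1, ih2⟩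
          · exact .inr ⟨ih.to_reflTransGen, .refl⟩
          · exact .inr ⟨ih1, .refl⟩
    have hp : IsPriority I F r₁ := by
      refine ⟨fun u hu => ?_, ?_⟩
      · rcases hgen u u hu with h1 | ⟨h1, h2⟩
        · exact h.1.acyclic u h1
        · rcases (Relation.reflTransGen_iff_eq_or_transGen.1 (h2.trans h1)) with h3 | h3
          · exact hne h3
          · exact hpath h3
      · rintro u v (h' | ⟨rfl, rfl⟩)
        · exact h.1.neighbors u v h'
        · exact hab
    have := h.2 r₁ hp (fun u v h' => .inl h')
    exact hr (this ▸ (.inr ⟨rfl, rfl⟩ : r₁ a b))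
  exact h.1.acyclic x ((key y x hn.symm hcon.2 hne.symm).trans (key x y hn hcon.1 hne))

/-- All neighbors of different rank are already oriented, so a further pair would run against the
rank and close a cycle of length two. -/
theorem isTotalPriority_of_rank (k : DBFact D S → ℕ) (hk : Set.InjOn k I) :
    IsTotalPriority I F (fun x y => Neighbors I F x y ∧ k x < k y) := by
  refine ⟨⟨fun x hx => ?_, fun x y h => h.1⟩, fun r' hr' hext => ?_⟩
  · have : ∀ y z, Relation.TransGen (fun x y => Neighbors I F x y ∧ k x < k y) y z →
        k y < k z := by
      intro y z h
      induction h with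
      | single h => exact h.2
      | tail _ h ih => exact ih.trans h.2
    exact lt_irrefl _ (this x x hx)
  · funext x y
    refine propext ⟨fun h => ⟨hr'.neighbors x y h, ?_⟩, hext x y⟩
    have hn := hr'.neighbors x y h
    by_contra! hle
    rcases hle.eq_or_lt with he | hlt
    · exact hr'.acyclic x (.single (hk hn.symm.mem_left hn.mem_left he ▸ h))
    · exact hr'.acyclic x (.tail (.single h) (hext y x ⟨hn.symm, hlt⟩))

/-! ### Executions and rankings -/

/-- The transitive closure of an acyclic relation is a strict order, hence well-founded on a finite
set. It follows that a complete execution exhausts `I`. -/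
theorem winnow_nonempty (hr : ∀ x, ¬ Relation.TransGen r x x) (hA : A.Finite)
    (hne : A.Nonempty) : (winnow r A).Nonempty := by
  have := hA.to_subtype
  let s : A → A → Prop := fun a b => Relation.TransGen r a b
  have : IsTrans A s := ⟨fun _ _ _ h1 h2 => Relation.TransGen.trans h1 h2⟩
  have : Std.Irrefl s := ⟨fun a h => hr a h⟩
  have hwf : WellFounded s := Finite.wellFounded_of_trans_of_irrefl s
  obtain ⟨a, ha⟩ := hne
  obtain ⟨m, -, hm⟩ := hwf.has_min Set.univ ⟨⟨a, ha⟩, trivial⟩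
  exact ⟨m, m.2, fun ⟨y, hy, h⟩ => hm ⟨y, hy⟩ trivial (.single h)⟩

theorem Run.length_le (h : Run F r A J xs A' J') (hA : A.Finite) : xs.length ≤ A.ncard := by
  induction h with
  | refl => simp
  | add x hx hc h ih =>
    have := Set.ncard_sdiff_singleton_add_one hx.1 hA
    have := ih (hA.subset Set.sdiff_subset)
    simp only [List.length_cons]; omega
  | discard x hx hc h ih =>
    have := Set.ncard_sdiff_singleton_add_one hx.1 hA
    have := ih (hA.subset Set.sdiff_subset)
    simp only [List.length_cons]; omega

theorem Run.subset (h : Run F r A J xs A' J') : A' ⊆ A := by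
  induction h with
  | refl => exact subset_rfl
  | add x hx hc h ih => exact ih.trans Set.sdiff_subset
  | discard x hx hc h ih => exact ih.trans Set.sdiff_subset

theorem Run.trans {ys : List (DBFact D S)} {A'' J'' : Set (DBFact D S)}
    (h : Run F r A J xs A' J') (h' : Run F r A' J' ys A'' J'') :
    Run F r A J (xs ++ ys) A'' J'' := by
  induction h with
  | refl => exact h'
  | add x hx hc h ih => exact .add x hx hc (ih h')
  | discard x hx hc h ih => exact .discard x hx hc (ih h')

/-- Fewer dominations leave more undominated facts, so every choice remains legal. -/
theorem Run.weaken (h : Run F r' A J xs A' J') (hext : Extends r' r) :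
    Run F r A J xs A' J' := by
  have hw : ∀ A, winnow r' A ⊆ winnow r A := fun A x hx =>
    ⟨hx.1, fun ⟨y, hy, h⟩ => hx.2 ⟨y, hy, hext _ _ h⟩⟩
  induction h with
  | refl => exact .refl _ _
  | add x hx hc h ih => exact .add x (hw _ hx) hc ih
  | discard x hx hc h ih => exact .discard x (hw _ hx) hc ih

theorem exists_run (hr : ∀ x, ¬ Relation.TransGen r x x) (hA : A.Finite) :
    ∃ xs J', Run F r A J xs ∅ J' := by
  induction hn : A.ncard generalizing A J with
  | zero =>
    obtain rfl := (Set.ncard_eq_zero hA).1 hn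
    exact ⟨[], J, .refl _ _⟩
  | succ n ih =>
    obtain ⟨x, hx⟩ := winnow_nonempty hr hA (Set.nonempty_of_ncard_ne_zero (by omega))
    have h1 := Set.ncard_sdiff_singleton_add_one hx.1 hA
    by_cases hc : Consistent F (insert x J)
    · obtain ⟨xs, J', h⟩ := ih (J := insert x J) (hA.subset Set.sdiff_subset)
        (show (A \ {x}).ncard = n by omega)
      exact ⟨_, _, .add x hx hc h⟩
    · obtain ⟨xs, J', h⟩ := ih (J := J) (hA.subset Set.sdiff_subset)
        (show (A \ {x}).ncard = n by omega)
      exact ⟨_, _, .discard x hx hc h⟩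

/-- `J` is the outcome of going through `I` in the order of increasing rank `k`, keeping each fact
that is consistent with those kept before. -/
structure GreedyFor (I : Set (DBFact D S)) (F : Set (DenialConstraint D S))
    (r : DBFact D S → DBFact D S → Prop) (k : DBFact D S → ℕ) (J : Set (DBFact D S)) : Prop where
  inj : Set.InjOn k I
  mono : ∀ x ∈ I, ∀ y ∈ I, r x y → k x < k y
  subset : J ⊆ I
  mem_iff : ∀ x ∈ I, x ∈ J ↔ Consistent F (insert x {z ∈ J | k z < k x})

/-- The rank is the position in the sequence of choices: the head gets `0` and later ranks shift by
one. The initial `J` is arbitrary so that the induction can absorb a kept head into it; disjointness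
from `A` ensures that a discarded head is not in the result. -/
theorem Run.exists_rank (h : Run F r A J xs ∅ J') (hJ : Disjoint J A) :
    ∃ k : DBFact D S → ℕ, Set.InjOn k A ∧ (∀ x ∈ A, ∀ y ∈ A, r x y → k x < k y) ∧
      J ⊆ J' ∧ J' ⊆ J ∪ A ∧
      ∀ x ∈ A, x ∈ J' ↔ Consistent F (insert x (J ∪ {z ∈ J' ∩ A | k z < k x})) := by
  classical
  generalize hE : (∅ : Set (DBFact D S)) = E at h
  induction h with
  | refl => subst hE; exact ⟨fun _ => 0, by simp⟩
  | @add A J xs A' J' x hx hc h ih =>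
    obtain ⟨k, h1, h2, h3, h4, h5⟩ := ih (by
      rw [Set.disjoint_left] at hJ ⊢
      rintro y (rfl | hy) ⟨hyA, hyx⟩
      · exact hyx rfl
      · exact hJ hy hyA) hE
    refine ⟨fun z => if z = x then 0 else k z + 1, ?_, ?_, ?_, ?_, ?_⟩
    · intro y hy z hz hyz
      by_cases hyx : y = x <;> by_cases hzx : z = x <;> simp_all
      exact h1 ⟨hy, hyx⟩ ⟨hz, hzx⟩ hyz
    · intro y hy z hz hyz
      have hzx : z ≠ x := by rintro rfl; exact hx.2 ⟨y, hy, hyz⟩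
      by_cases hyx : y = x
      · simp [hyx, hzx]
      · simpa [hyx, hzx] using h2 y ⟨hy, hyx⟩ z ⟨hz, hzx⟩ hyz
    · exact (Set.subset_insert _ _).trans h3
    · intro y hy
      rcases h4 hy with (rfl | hy) | hy
      · exact .inr hx.1
      · exact .inl hy
      · exact .inr hy.1
    · intro y hy
      by_cases hyx : y = x
      · subst hyx
        simpa [h3 (Set.mem_insert y J)] using hc
      · rw [h5 y ⟨hy, hyx⟩]
        congr! 2
        ext z
        have hxJ : x ∈ J' := h3 (Set.mem_insert x J)
        have hxA := hx.1
        by_cases hzx : z = x <;> simp_all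
        tauto
  | @discard A J xs A' J' x hx hc h ih =>
    obtain ⟨k, h1, h2, h3, h4, h5⟩ := ih (hJ.mono_right Set.sdiff_subset) hE
    have hxJ : x ∉ J' := by
      intro h'
      rcases h4 h' with h' | h'
      · exact Set.disjoint_left.1 hJ h' hx.1
      · exact h'.2 rfl
    refine ⟨fun z => if z = x then 0 else k z + 1, ?_, ?_, h3, ?_, ?_⟩
    · intro y hy z hz hyz
      by_cases hyx : y = x <;> by_cases hzx : z = x <;> simp_all
      exact h1 ⟨hy, hyx⟩ ⟨hz, hzx⟩ hyz
    · intro y hy z hz hyz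
      have hzx : z ≠ x := by rintro rfl; exact hx.2 ⟨y, hy, hyz⟩
      by_cases hyx : y = x
      · simp [hyx, hzx]
      · simpa [hyx, hzx] using h2 y ⟨hy, hyx⟩ z ⟨hz, hzx⟩ hyz
    · intro y hy
      exact (h4 hy).imp id (fun h => h.1)
    · intro y hy
      by_cases hyx : y = x
      · subst hyx
        simpa [hxJ] using hc
      · rw [h5 y ⟨hy, hyx⟩]
        congr! 2
        ext z
        by_cases hzx : z = x <;> simp_all
        tauto

theorem Run.exists_greedyFor (h : Run F r I ∅ xs ∅ J) : ∃ k, GreedyFor I F r k J := by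
  obtain ⟨k, h1, h2, -, h4, h5⟩ := h.exists_rank (Set.empty_disjoint _)
  rw [Set.empty_union] at h4
  refine ⟨k, h1, h2, h4, fun x hx => ?_⟩
  rw [h5 x hx, Set.empty_union, Set.inter_eq_left.2 h4]

theorem Execution.run (h : Execution I F r xs J) (hI : I.Finite)
    (hr : ∀ x, ¬ Relation.TransGen r x x) : Run F r I ∅ xs ∅ J := by
  obtain ⟨A, h1, h2⟩ := h
  rcases A.eq_empty_or_nonempty with rfl | hne
  · exact h1
  · exact absurd h2 (winnow_nonempty hr (hI.subset h1.subset) hne).ne_empty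

/-! ### Greedy outcomes and common optimal repairs -/

/-- The member of `J` of largest rank was tested against all the others. -/
theorem GreedyFor.consistent {k : DBFact D S → ℕ} (h : GreedyFor I F r k J) (hI : I.Finite) :
    Consistent F J := by
  rcases J.eq_empty_or_nonempty with rfl | hne
  · exact consistent_empty
  · obtain ⟨x, hx, hmax⟩ := Set.exists_max_image J k (hI.subset h.subset) hne
    refine ((h.mem_iff x (h.subset hx)).1 hx).mono fun y hy => ?_
    rcases (hmax y hy).eq_or_lt with he | hlt
    · exact .inl (h.inj (h.subset hy) (h.subset hx) he)
    · exact .inr ⟨hy, hlt⟩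

theorem GreedyFor.isRepair {k : DBFact D S → ℕ} (h : GreedyFor I F r k J) (hI : I.Finite) :
    IsRepair I F J := by
  refine ⟨⟨h.subset, h.consistent hI⟩, fun J' hJ' hle x hx => ?_⟩
  refine (h.mem_iff x (hJ'.1 hx)).2 (hJ'.2.mono ?_)
  rintro y (rfl | hy)
  · exact hx
  · exact hle hy.1

/-- Let `y` have least rank in `Y`. Each element of `X` is beaten by some element of `Y`, so it
ranks after `y`. The exchanged set thus contains `y` and all facts of `J` ranked before it, and its
consistency would have put `y` into `J`. -/
theorem GreedyFor.commonOptimal {k : DBFact D S → ℕ} (h : GreedyFor I F r k J)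
    (hr : IsPriority I F r) : CommonOptimal I F r J := by
  refine ⟨_, isTotalPriority_of_rank k h.inj, fun x y hxy => ?_, h.subset, ?_⟩
  · have hn := hr.neighbors x y hxy
    exact ⟨hn, h.mono x hn.mem_left y hn.symm.mem_left hxy⟩
  · intro X Y hX hXne hY hXY hcons
    have hYne : Y.Nonempty := by
      obtain ⟨x, hx⟩ := hXne
      obtain ⟨y, hy, -⟩ := hXY x hx
      exact ⟨y, hy⟩
    obtain ⟨y, hy, hmin⟩ := (measure k).wf.has_min Y hYne
    refine (hY hy).2 ((h.mem_iff y (hY hy).1).2 (hcons.mono ?_))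
    rintro z (rfl | ⟨hz, hzy⟩)
    · exact .inr hy
    · refine .inl ⟨hz, fun hzX => ?_⟩
      obtain ⟨y', hy', -, hlt⟩ := hXY z hzX
      exact hmin y' hy' (hlt.trans hzy)

/-- The set `J'` only supplies a rank compatible with `r`; the point is that `J` obeys the greedy
rule for the same rank. -/
theorem GloballyOptimal.greedyFor {k : DBFact D S → ℕ} (h : GreedyFor I F r k J')
    (ht : IsTotalPriority I F r) (hrep : IsRepair I F J) (hopt : GloballyOptimal I F r J) :
    GreedyFor I F r k J := by
  refine ⟨h.inj, h.mono, hopt.1, fun x hx => ⟨fun hxJ => ?_, fun hc => ?_⟩⟩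
  · refine hrep.prop.2.mono ?_
    rintro y (rfl | hy)
    · exact hxJ
    · exact hy.1
  · by_contra hxJ
    -- A conflict avoiding `x` would lie in `J`. In one containing `x`, any other member is
    -- comparable to `x` but not dominated by it, so it dominates `x` and has smaller rank,
    -- contradicting `hc`.
    have hcons : Consistent F ((J \ {z ∈ J | r x z}) ∪ {x}) := by
      by_contra hcon
      obtain ⟨C, hC⟩ := exists_conflict hcon
      have hsub : (J \ {z ∈ J | r x z}) ∪ {x} ⊆ I := by
        rintro z (hz | rfl)
        · exact hopt.1 hz.1
        · exact hx
      by_cases hxC : x ∈ C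
      · refine hC.not_consistent (fun z hz => ?_) hc
        by_cases hzx : z = x
        · exact .inl hzx
        rcases hC.1 hz with hz' | hz'
        · have hn : Neighbors I F x z := ⟨C, hC.mono hsub, hxC, hz⟩
          rcases ht.comparable hn (Ne.symm hzx) with h1 | h1
          · exact absurd ⟨hz'.1, h1⟩ hz'.2
          · exact .inr ⟨hz'.1, h.mono z hn.symm.mem_left x hx h1⟩
        · exact absurd hz' hzx
      · refine hC.not_consistent (fun z hz => ?_) hrep.prop.2
        rcases hC.1 hz with hz' | rfl
        · exact hz'.1
        · exact absurd hz hxC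
    -- If nothing is deleted, maximality of the repair is violated; otherwise global optimality is.
    rcases Set.eq_empty_or_nonempty {z ∈ J | r x z} with he | hne
    · rw [he, Set.sdiff_empty] at hcons
      refine hxJ (hrep.le_of_ge ⟨?_, hcons⟩ Set.subset_union_left (.inr rfl))
      rintro z (hz | rfl)
      · exact hopt.1 hz
      · exact hx
    · refine hopt.2 _ {x} (fun z hz => hz.1) hne ?_ (fun z hz => ⟨x, rfl, hz.2⟩) hcons
      rintro z rfl
      exact ⟨hx, hxJ⟩

theorem GreedyFor.unique {k : DBFact D S → ℕ} (h : GreedyFor I F r k J)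
    (h' : GreedyFor I F r' k J') : J = J' := by
  have key : ∀ n, ∀ x ∈ I, k x = n → (x ∈ J ↔ x ∈ J') := by
    intro n
    induction n using Nat.strong_induction_on with
    | _ n ih =>
      intro x hx hxn
      rw [h.mem_iff x hx, h'.mem_iff x hx]
      congr! 2
      ext z
      constructor
      · rintro ⟨hz, hlt⟩
        exact ⟨(ih _ (hxn ▸ hlt) z (h.subset hz) rfl).1 hz, hlt⟩
      · rintro ⟨hz, hlt⟩
        exact ⟨(ih _ (hxn ▸ hlt) z (h'.subset hz) rfl).2 hz, hlt⟩
  ext x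
  exact ⟨fun hx => (key _ x (h.subset hx) rfl).1 hx, fun hx => (key _ x (h'.subset hx) rfl).2 hx⟩

/-- The outputs of the greedy algorithm are exactly the common optimal repairs. -/
theorem outputs_eq_cRep (hI : I.Finite) (hr : IsPriority I F r) :
    {J | ∃ xs, Execution I F r xs J} = CRep I F r := by
  ext J
  constructor
  · rintro ⟨xs, h⟩
    obtain ⟨k, hk⟩ := (h.run hI hr.acyclic).exists_greedyFor
    exact ⟨hk.isRepair hI, hk.commonOptimal hr⟩
  · rintro ⟨hrep, r', ht, hext, hopt⟩
    -- Any run for the total priority will do: its rank already forces `J = J'`.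
    obtain ⟨xs, J', h⟩ := exists_run (F := F) (J := ∅) ht.1.acyclic hI
    obtain ⟨k, hk⟩ := h.exists_greedyFor
    obtain rfl := (hopt.greedyFor hk ht hrep).unique hk
    exact ⟨xs, ∅, h.weaken hext, by simp [winnow]⟩

end Greedy

section Logic

variable {D : Type u} {Rel : Type v}

/-! ### A program logic with time bounds -/

/-- `Ensures m c σ T Q`: started in `σ`, the command `c` halts within time `T` in a state satisfying
`Q`. For `m = false` this holds however the choices of `c` are made, for `m = true` they are made
favourably. -/
inductive Ensures (m : Bool) :
    Cmd D Rel → (ℕ → Val D Rel) → ℕ → ((ℕ → Val D Rel) → Prop) → Prop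
  | skip {σ T Q} (hT : 1 ≤ T) (h : Q σ) : Ensures m .skip σ T Q
  | assign {n e σ T Q} (hT : e.cost + 1 ≤ T) (h : Q (Function.update σ n (e.eval σ))) :
      Ensures m (.assign n e) σ T Q
  | seq {c₁ c₂ σ T₁ T₂ T Q₁ Q} (h₁ : Ensures m c₁ σ T₁ Q₁)
      (h₂ : ∀ τ, Q₁ τ → Ensures m c₂ τ T₂ Q) (hT : T₁ + T₂ + 1 ≤ T) :
      Ensures m (.seq c₁ c₂) σ T Q
  | ite {b c₁ c₂ σ T₁ T Q} (h₁ : b.Holds σ → Ensures m c₁ σ T₁ Q)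
      (h₂ : ¬ b.Holds σ → Ensures m c₂ σ T₁ Q) (hT : b.cost σ + 1 + T₁ ≤ T) :
      Ensures m (.ite b c₁ c₂) σ T Q
  | loop_true {b c σ T₁ T₂ T Q₁ Q} (hb : b.Holds σ) (h₁ : Ensures m c σ T₁ Q₁)
      (h₂ : ∀ τ, Q₁ τ → Ensures m (.loop b c) τ T₂ Q) (hT : b.cost σ + 1 + T₁ + T₂ ≤ T) :
      Ensures m (.loop b c) σ T Q
  | loop_false {b c σ T Q} (hb : ¬ b.Holds σ) (hT : b.cost σ + 1 ≤ T) (h : Q σ) :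
      Ensures m (.loop b c) σ T Q
  | choose {c₁ c₂ σ T₁ T Q} (h₁ : Ensures m c₁ σ T₁ Q) (h₂ : Ensures m c₂ σ T₁ Q)
      (hT : T₁ + 1 ≤ T) : Ensures m (.choose c₁ c₂) σ T Q
  | choose_left {c₁ c₂ σ T₁ T Q} (hm : m = true) (h₁ : Ensures m c₁ σ T₁ Q)
      (hT : T₁ + 1 ≤ T) : Ensures m (.choose c₁ c₂) σ T Q
  | choose_right {c₁ c₂ σ T₁ T Q} (hm : m = true) (h₂ : Ensures m c₂ σ T₁ Q)
      (hT : T₁ + 1 ≤ T) : Ensures m (.choose c₁ c₂) σ T Q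

variable {m : Bool} {c : Cmd D Rel} {b : Test D Rel} {σ : ℕ → Val D Rel} {T T₁ B N : ℕ}
  {Q Q' : (ℕ → Val D Rel) → Prop}

theorem Ensures.mono (h : Ensures m c σ T₁ Q) (hT : T₁ ≤ T) (hQ : ∀ τ, Q τ → Q' τ) :
    Ensures m c σ T Q' := by
  induction h generalizing T Q' with
  | skip hT' h => exact .skip (hT'.trans hT) (hQ _ h)
  | assign hT' h => exact .assign (hT'.trans hT) (hQ _ h)
  | seq h₁ _ hT' _ ih₂ => exact .seq h₁ (fun τ hτ => ih₂ τ hτ le_rfl hQ) (hT'.trans hT)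
  | ite _ _ hT' ih₁ ih₂ =>
    exact .ite (fun h => ih₁ h le_rfl hQ) (fun h => ih₂ h le_rfl hQ) (hT'.trans hT)
  | loop_true hb h₁ _ hT' _ ih₂ =>
    exact .loop_true hb h₁ (fun τ hτ => ih₂ τ hτ le_rfl hQ) (hT'.trans hT)
  | loop_false hb hT' h => exact .loop_false hb (hT'.trans hT) (hQ _ h)
  | choose _ _ hT' ih₁ ih₂ => exact .choose (ih₁ le_rfl hQ) (ih₂ le_rfl hQ) (hT'.trans hT)
  | choose_left hm _ hT' ih => exact .choose_left hm (ih le_rfl hQ) (hT'.trans hT)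
  | choose_right hm _ hT' ih => exact .choose_right hm (ih le_rfl hQ) (hT'.trans hT)

/-- The register `n` is assigned to in the command. -/
def Cmd.Writes (n : ℕ) : Cmd D Rel → Prop
  | .skip => False
  | .assign k _ => n = k
  | .seq c₁ c₂ => c₁.Writes n ∨ c₂.Writes n
  | .ite _ c₁ c₂ => c₁.Writes n ∨ c₂.Writes n
  | .loop _ c => c.Writes n
  | .choose c₁ c₂ => c₁.Writes n ∨ c₂.Writes n

/-- Lets each specification mention only the registers that its command changes. -/
theorem Ensures.frame (h : Ensures m c σ T Q) :
    Ensures m c σ T (fun τ => Q τ ∧ ∀ n, ¬ c.Writes n → τ n = σ n) := by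
  induction h with
  | skip hT h => exact .skip hT ⟨h, fun _ _ => rfl⟩
  | assign hT h =>
    exact .assign hT ⟨h, fun n hn => Function.update_of_ne (by simpa [Cmd.Writes] using hn) _ _⟩
  | seq _ _ hT ih₁ ih₂ =>
    refine .seq ih₁ (fun τ hτ => (ih₂ τ hτ.1).mono le_rfl fun τ' hτ' => ⟨hτ'.1, fun n hn => ?_⟩) hT
    simp only [Cmd.Writes, not_or] at hn
    rw [hτ'.2 n hn.2, hτ.2 n hn.1]
  | ite _ _ hT ih₁ ih₂ =>
    refine .ite (fun h => (ih₁ h).mono le_rfl fun τ hτ => ⟨hτ.1, fun n hn => hτ.2 n ?_⟩)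
      (fun h => (ih₂ h).mono le_rfl fun τ hτ => ⟨hτ.1, fun n hn => hτ.2 n ?_⟩) hT
    all_goals simp only [Cmd.Writes, not_or] at hn; tauto
  | loop_true hb _ _ hT ih₁ ih₂ =>
    refine .loop_true hb ih₁
      (fun τ hτ => (ih₂ τ hτ.1).mono le_rfl fun τ' hτ' => ⟨hτ'.1, fun n hn => ?_⟩) hT
    rw [hτ'.2 n hn, hτ.2 n hn]
  | loop_false hb hT h => exact .loop_false hb hT ⟨h, fun _ _ => rfl⟩
  | choose _ _ hT ih₁ ih₂ =>
    refine .choose (ih₁.mono le_rfl fun τ hτ => ⟨hτ.1, fun n hn => hτ.2 n ?_⟩)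
      (ih₂.mono le_rfl fun τ hτ => ⟨hτ.1, fun n hn => hτ.2 n ?_⟩) hT
    all_goals simp only [Cmd.Writes, not_or] at hn; tauto
  | choose_left hm _ hT ih =>
    refine .choose_left hm (ih.mono le_rfl fun τ hτ => ⟨hτ.1, fun n hn => hτ.2 n ?_⟩) hT
    simp only [Cmd.Writes, not_or] at hn; tauto
  | choose_right hm _ hT ih =>
    refine .choose_right hm (ih.mono le_rfl fun τ hτ => ⟨hτ.1, fun n hn => hτ.2 n ?_⟩) hT
    simp only [Cmd.Writes, not_or] at hn; tauto

/-- Every run of a command either is still within the command, or has left it. -/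
theorem Ensures.reaches_cases (h : Ensures false c σ T Q) {K : List (Cmd D Rel)} {t : ℕ}
    {d : Config D Rel} (hr : Reaches (c :: K, σ) t d) :
    (t ≤ T ∧ d.1 ≠ []) ∨
      ∃ t₁ t₂ τ, t = t₁ + t₂ ∧ t₁ ≤ T ∧ Q τ ∧ Reaches (K, τ) t₂ d := by
  induction h generalizing K t d with
  | skip hT h =>
    cases hr with
    | refl => exact .inl ⟨by omega, by simp⟩
    | step hs hr => cases hs; exact .inr ⟨_, _, _, rfl, hT, h, hr⟩
  | assign hT h =>
    cases hr with
    | refl => exact .inl ⟨by omega, by simp⟩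
    | step hs hr => cases hs; exact .inr ⟨_, _, _, rfl, hT, h, hr⟩
  | seq _ _ hT ih₁ ih₂ =>
    cases hr with
    | refl => exact .inl ⟨by omega, by simp⟩
    | step hs hr =>
      cases hs
      rcases ih₁ hr with ⟨h1, h2⟩ | ⟨t₁, t₂, τ, rfl, h1, h2, h3⟩
      · exact .inl ⟨by omega, h2⟩
      · rcases ih₂ τ h2 h3 with ⟨h1, h2⟩ | ⟨t₃, t₄, τ', rfl, h4, h5, h6⟩
        · exact .inl ⟨by omega, h2⟩
        · exact .inr ⟨1 + t₁ + t₃, t₄, τ', by omega, by omega, h5, h6⟩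
  | ite _ _ hT ih₁ ih₂ =>
    cases hr with
    | refl => exact .inl ⟨by omega, by simp⟩
    | step hs hr =>
      cases hs with
      | ite_true _ _ _ _ _ hb =>
        rcases ih₁ hb hr with ⟨h1, h2⟩ | ⟨t₁, t₂, τ, rfl, h1, h2, h3⟩
        · exact .inl ⟨by omega, h2⟩
        · exact .inr ⟨_, _, _, (add_assoc _ _ _).symm, by omega, h2, h3⟩
      | ite_false _ _ _ _ _ hb =>
        rcases ih₂ hb hr with ⟨h1, h2⟩ | ⟨t₁, t₂, τ, rfl, h1, h2, h3⟩
        · exact .inl ⟨by omega, h2⟩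
        · exact .inr ⟨_, _, _, (add_assoc _ _ _).symm, by omega, h2, h3⟩
  | @loop_true b _ σ _ _ _ _ _ hb _ _ hT ih₁ ih₂ =>
    cases hr with
    | refl => exact .inl ⟨by omega, by simp⟩
    | step hs hr =>
      cases hs with
      | loop_true _ _ _ _ _ =>
        rcases ih₁ hr with ⟨h1, h2⟩ | ⟨t₁, t₂, τ, rfl, h1, h2, h3⟩
        · exact .inl ⟨by omega, h2⟩
        · rcases ih₂ τ h2 h3 with ⟨h1, h2⟩ | ⟨t₃, t₄, τ', rfl, h4, h5, h6⟩
          · exact .inl ⟨by omega, h2⟩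
          · exact .inr ⟨b.cost σ + 1 + t₁ + t₃, t₄, τ', by omega, by omega, h5, h6⟩
      | loop_false _ _ _ _ hb' => exact absurd hb hb'
  | loop_false hb hT h =>
    cases hr with
    | refl => exact .inl ⟨by omega, by simp⟩
    | step hs hr =>
      cases hs with
      | loop_true _ _ _ _ hb' => exact absurd hb' hb
      | loop_false _ _ _ _ _ => exact .inr ⟨_, _, _, rfl, hT, h, hr⟩
  | choose _ _ hT ih₁ ih₂ =>
    cases hr with
    | refl => exact .inl ⟨by omega, by simp⟩
    | step hs hr =>
      cases hs with
      | choose_left _ _ _ _ =>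
        rcases ih₁ hr with ⟨h1, h2⟩ | ⟨t₁, t₂, τ, rfl, h1, h2, h3⟩
        · exact .inl ⟨by omega, h2⟩
        · exact .inr ⟨_, _, _, (add_assoc _ _ _).symm, by omega, h2, h3⟩
      | choose_right _ _ _ _ =>
        rcases ih₂ hr with ⟨h1, h2⟩ | ⟨t₁, t₂, τ, rfl, h1, h2, h3⟩
        · exact .inl ⟨by omega, h2⟩
        · exact .inr ⟨_, _, _, (add_assoc _ _ _).symm, by omega, h2, h3⟩
  | choose_left hm' => exact absurd hm' (by simp)
  | choose_right hm' => exact absurd hm' (by simp)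

theorem Reaches.trans {a b c : Config D Rel} {s t : ℕ} (h : Reaches a s b) (h' : Reaches b t c) :
    Reaches a (s + t) c := by
  induction h with
  | refl => simpa using h'
  | step hs _ ih => rw [add_assoc]; exact .step hs (ih h')

/-- Some run of the command ends in a state as promised. -/
theorem Ensures.exists_reaches (h : Ensures m c σ T Q) :
    ∃ τ, Q τ ∧ ∀ K, ∃ t, Reaches (c :: K, σ) t (K, τ) := by
  induction h with
  | skip hT h => exact ⟨_, h, fun K => ⟨_, .step (.skip _ _) (.refl _)⟩⟩
  | assign hT h => exact ⟨_, h, fun K => ⟨_, .step (.assign _ _ _ _) (.refl _)⟩⟩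
  | seq _ _ hT ih₁ ih₂ =>
    obtain ⟨τ, hτ, h1⟩ := ih₁
    obtain ⟨τ', hτ', h2⟩ := ih₂ τ hτ
    refine ⟨τ', hτ', fun K => ?_⟩
    obtain ⟨t₁, h1⟩ := h1 (_ :: K)
    obtain ⟨t₂, h2⟩ := h2 K
    exact ⟨_, .step (.seq _ _ _ _) (h1.trans h2)⟩
  | @ite b _ _ σ _ _ _ _ _ hT ih₁ ih₂ =>
    by_cases hb : b.Holds σ
    · obtain ⟨τ, hτ, h1⟩ := ih₁ hb
      exact ⟨τ, hτ, fun K => ⟨_, .step (.ite_true _ _ _ _ _ hb) (h1 K).choose_spec⟩⟩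
    · obtain ⟨τ, hτ, h1⟩ := ih₂ hb
      exact ⟨τ, hτ, fun K => ⟨_, .step (.ite_false _ _ _ _ _ hb) (h1 K).choose_spec⟩⟩
  | loop_true hb _ _ hT ih₁ ih₂ =>
    obtain ⟨τ, hτ, h1⟩ := ih₁
    obtain ⟨τ', hτ', h2⟩ := ih₂ τ hτ
    refine ⟨τ', hτ', fun K => ?_⟩
    obtain ⟨t₁, h1⟩ := h1 (_ :: K)
    obtain ⟨t₂, h2⟩ := h2 K
    exact ⟨_, .step (.loop_true _ _ _ _ hb) (h1.trans h2)⟩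
  | loop_false hb hT h => exact ⟨_, h, fun K => ⟨_, .step (.loop_false _ _ _ _ hb) (.refl _)⟩⟩
  | choose _ _ hT ih₁ ih₂ =>
    obtain ⟨τ, hτ, h1⟩ := ih₁
    exact ⟨τ, hτ, fun K => ⟨_, .step (.choose_left _ _ _ _) (h1 K).choose_spec⟩⟩
  | choose_left hm _ hT ih =>
    obtain ⟨τ, hτ, h1⟩ := ih
    exact ⟨τ, hτ, fun K => ⟨_, .step (.choose_left _ _ _ _) (h1 K).choose_spec⟩⟩
  | choose_right hm _ hT ih =>
    obtain ⟨τ, hτ, h1⟩ := ih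
    exact ⟨τ, hτ, fun K => ⟨_, .step (.choose_right _ _ _ _) (h1 K).choose_spec⟩⟩

theorem Reaches.eq_of_halted {d : Config D Rel} {t : ℕ} (h : Reaches ([], σ) t d) :
    t = 0 ∧ d = ([], σ) := by
  cases h with
  | refl => exact ⟨rfl, rfl⟩
  | step hs => cases hs

theorem Ensures.haltsWithin {P : Cmd D Rel} {input : Val D Rel}
    (h : Ensures false P (Function.update (fun _ => .nil) 0 input) T Q) :
    HaltsWithin P input T := by
  intro t d hr
  rcases h.reaches_cases hr with h1 | ⟨t₁, t₂, τ, rfl, h1, -, h2⟩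
  · exact h1.1
  · obtain ⟨rfl, -⟩ := h2.eq_of_halted
    exact h1

theorem Ensures.of_returns {R : Val D Rel → Prop} {P : Cmd D Rel} {input out : Val D Rel}
    (h : Ensures false P (Function.update (fun _ => .nil) 0 input) T (fun τ => R (τ 0)))
    (hr : Returns P input out) : R out := by
  obtain ⟨t, σ, hr, rfl⟩ := hr
  rcases h.reaches_cases hr with h1 | ⟨t₁, t₂, τ, rfl, h1, hq, h2⟩
  · exact absurd rfl h1.2
  · obtain ⟨-, h2⟩ := h2.eq_of_halted
    simp only [Prod.mk.injEq, true_and] at h2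
    exact h2 ▸ hq

theorem Ensures.exists_returns {P : Cmd D Rel} {input : Val D Rel}
    (h : Ensures m P (Function.update (fun _ => .nil) 0 input) T Q) :
    ∃ τ, Q τ ∧ Returns P input (τ 0) := by
  obtain ⟨τ, hτ, h1⟩ := h.exists_reaches
  obtain ⟨t, h1⟩ := h1 []
  exact ⟨τ, hτ, t, τ, h1, rfl⟩

/-! ### Rules for loops -/

/-- The index of `Inv` counts the iterations still to come, so it serves as variant and time bound
at once. -/
theorem Ensures.loop {Inv : ℕ → (ℕ → Val D Rel) → Prop}
    (hstep : ∀ n σ, Inv (n + 1) σ → b.Holds σ ∧ b.cost σ ≤ B ∧ Ensures m c σ T (Inv n))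
    (hzero : ∀ σ, Inv 0 σ → ¬ b.Holds σ ∧ b.cost σ ≤ B) {n : ℕ} (h : Inv n σ) :
    Ensures m (.loop b c) σ (n * (T + B + 1) + B + 1) (Inv 0) := by
  induction n generalizing σ with
  | zero =>
    obtain ⟨h1, h2⟩ := hzero σ h
    exact .loop_false h1 (by omega) h
  | succ n ih =>
    obtain ⟨h1, h2, h3⟩ := hstep n σ h
    refine .loop_true h1 h3 (fun τ hτ => ih hτ) ?_
    rw [Nat.succ_mul]; omega

/-- Run `body` on each element of the list `src`, the register `i` holding the list of those
elements that are still to be treated. -/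
def Cmd.forEach (i : ℕ) (src : Expr D Rel) (body : Cmd D Rel) : Cmd D Rel :=
  .seq (.assign i src)
    (.loop (.not (.isNil (.reg i))) (.seq body (.assign i (.tl (.reg i)))))

theorem Cmd.writes_forEach {i n : ℕ} {src : Expr D Rel} {body : Cmd D Rel} :
    (Cmd.forEach i src body).Writes n ↔ n = i ∨ body.Writes n := by
  simp only [forEach, Writes]; tauto

/-- `Inv` speaks of the prefix already treated. The body is to establish it as seen after register
`i` has advanced, and `N` replaces the length so that nested loops get uniform bounds. -/
theorem Ensures.forEach {α : Type*} {enc : α → Val D Rel} {i : ℕ} {src : Expr D Rel}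
    {body : Cmd D Rel} {l : List α} {Inv : List α → (ℕ → Val D Rel) → Prop}
    (hsrc : src.eval σ = .ofList (l.map enc)) (hlen : l.length ≤ N) (hi : ¬ body.Writes i)
    (hinit : Inv [] (Function.update σ i (.ofList (l.map enc))))
    (hstep : ∀ pre a post τ, l = pre ++ a :: post → τ i = .ofList ((a :: post).map enc) →
      (∀ n, n ≠ i → ¬ body.Writes n → τ n = σ n) → Inv pre τ →
      Ensures m body τ T
        (fun τ' => Inv (pre ++ [a]) (Function.update τ' i (.ofList (post.map enc))))) :
    Ensures m (Cmd.forEach i src body) σ (N * (T + 8) + src.cost + 6) (Inv l) := by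
  let R : ℕ → (ℕ → Val D Rel) → Prop := fun n τ =>
    ∃ pre post, l = pre ++ post ∧ post.length = n ∧ τ i = .ofList (post.map enc) ∧
      (∀ n, n ≠ i → ¬ body.Writes n → τ n = σ n) ∧ Inv pre τ
  have hloop : Ensures m (.loop (.not (.isNil (.reg i))) (.seq body (.assign i (.tl (.reg i)))))
      (Function.update σ i (.ofList (l.map enc))) (l.length * (T + 4 + 3 + 1) + 3 + 1) (R 0) := by
    -- The `4` pays for advancing register `i` (`3`) and for sequencing (`1`); the emptiness test
    -- costs `3`.
    refine Ensures.loop (T := T + 4) (B := 3) (Inv := R) ?_ ?_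
      ⟨[], l, rfl, rfl, by simp, fun n hn _ => Function.update_of_ne hn _ _, hinit⟩
    · rintro n τ ⟨pre, post, hl, hn, hτ, hfr, hinv⟩
      obtain ⟨a, post, rfl⟩ := List.exists_cons_of_length_eq_add_one hn
      refine ⟨by simp [Test.Holds, Expr.eval, hτ, Val.ofList], by simp [Test.cost, Expr.cost], ?_⟩
      refine .seq (hstep pre a post τ hl hτ hfr hinv).frame (T₂ := 3) (fun τ' hτ' => ?_) (by omega)
      have hval : (Expr.tl (.reg i) : Expr D Rel).eval τ' = .ofList (post.map enc) := by
        simp [Expr.eval, hτ'.2 i hi, hτ, Val.ofList, Val.tl]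
      refine .assign (by simp [Expr.cost]) ⟨pre ++ [a], post, by simp [hl], by simpa using hn,
        by rw [hval]; simp, fun n hn hw => ?_, hval ▸ hτ'.1⟩
      rw [Function.update_of_ne hn, hτ'.2 n hw, hfr n hn hw]
    · rintro τ ⟨pre, post, hl, hn, hτ, -, -⟩
      obtain rfl := List.length_eq_zero_iff.1 hn
      exact ⟨by simp [Test.Holds, Expr.eval, hτ, Val.ofList], by simp [Test.cost, Expr.cost]⟩
  refine .seq (.assign (T := src.cost + 1) le_rfl (Q := fun τ => τ = _) rfl)
    (T₂ := N * (T + 8) + 4) ?_ (by omega)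
  rintro τ rfl
  rw [hsrc]
  refine hloop.mono ?_ ?_
  · have : l.length * (T + 4 + 3 + 1) ≤ N * (T + 8) := by gcongr
    omega
  · rintro τ ⟨pre, post, hl, hn, -, -, hinv⟩
    obtain rfl := List.length_eq_zero_iff.1 hn
    simpa [hl] using hinv

/-- Search a list for an element with the property `φ`, raising the flag in register `k` if there
is one. -/
theorem Ensures.search {α : Type*} {enc : α → Val D Rel} {φ : α → Prop} {i k : ℕ}
    {src : Expr D Rel} {body : Cmd D Rel} {l : List α}
    (hsrc : src.eval σ = .ofList (l.map enc)) (hlen : l.length ≤ N) (hi : ¬ body.Writes i)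
    (hik : k ≠ i)
    (hstep : ∀ a ∈ l, ∀ τ, (τ i).hd = enc a →
      (∀ n, n ≠ i → ¬ body.Writes n → τ n = σ n) →
      Ensures m body τ T (fun τ' => τ' k ≠ .nil ↔ τ k ≠ .nil ∨ φ a)) :
    Ensures m (Cmd.forEach i src body) σ (N * (T + 8) + src.cost + 6)
      (fun τ => τ k ≠ .nil ↔ σ k ≠ .nil ∨ ∃ a ∈ l, φ a) := by
  refine Ensures.forEach (Inv := fun pre τ => τ k ≠ .nil ↔ σ k ≠ .nil ∨ ∃ a ∈ pre, φ a)
    hsrc hlen hi (by simp [Function.update_of_ne hik]) ?_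
  intro pre a post τ hl hτ hfr hinv
  refine (hstep a (by simp [hl]) τ (by simp [hτ, Val.ofList, Val.hd]) hfr).mono le_rfl ?_
  intro τ' hτ'
  rw [Function.update_of_ne hik, hτ', hinv]
  simp only [List.mem_append, List.mem_singleton, or_and_right, exists_or, exists_eq_left, or_assoc]

end Logic

section Check

variable {D : Type u} {Rel : Type v} {S : Schema Rel} {σ : ℕ → Val D Rel}
  {g : ℕ → DBFact D S} {ρ : Var → Const D}

/-! ### Testing a constraint -/

@[simp]
theorem Val.hd_cons (a b : Val D Rel) : (Val.cons a b).hd = a := rfl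

@[simp]
theorem Val.tl_cons (a b : Val D Rel) : (Val.cons a b).tl = b := rfl

/-- The `k`-th element of a list. -/
def Expr.nth : ℕ → Expr D Rel → Expr D Rel
  | 0, e => .hd e
  | k + 1, e => (Expr.tl e).nth k

theorem Expr.eval_nth {l : List (Val D Rel)} {k : ℕ} (hk : k < l.length) {e : Expr D Rel}
    (he : e.eval σ = .ofList l) : (e.nth k).eval σ = l[k] := by
  induction k generalizing e l with
  | zero =>
    obtain ⟨a, l, rfl⟩ := List.exists_cons_of_length_pos hk
    simp [nth, eval, he, Val.ofList]
  | succ k ih =>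
    obtain ⟨a, l, rfl⟩ := List.exists_cons_of_length_pos (Nat.zero_lt_of_lt hk)
    exact ih (by simpa using hk) (by simp [eval, he, Val.ofList])

/-- The first `n` registers from `20` on hold lists starting with the facts `g 0, …, g (n - 1)`. -/
def Loaded (n : ℕ) (g : ℕ → DBFact D S) (σ : ℕ → Val D Rel) : Prop :=
  ∀ j < n, (σ (20 + j)).hd = (g j).encode

/-- The `k`-th argument of the fact at the head of register `20 + j`. -/
def argExpr (j k : ℕ) : Expr D Rel :=
  (Expr.tl (.hd (.reg (20 + j)))).nth k

theorem eval_argExpr {j k : ℕ} (h : (σ (20 + j)).hd = (g j).encode)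
    (hk : k < (g j).args.length) : (argExpr j k).eval σ = .const (g j).args[k] := by
  rw [argExpr, Expr.eval_nth (l := (g j).args.map .const) (by simpa using hk)]
  · simp
  · simp [Expr.eval, h, DBFact.encode]

open Classical in
/-- An argument at which the variable `x` occurs in one of the atoms. -/
noncomputable def occExpr (atoms : List (RelAtom S)) (x : Var) : Expr D Rel :=
  if h : ∃ p : ℕ × ℕ, ∃ a, atoms[p.1]? = some a ∧ a.vars[p.2]? = some x then
    argExpr h.choose.1 h.choose.2
  else .nil

/-- The occurrence selected by `occExpr` need not be the given one, hence the fresh `j`, `k` and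
atom. -/
theorem occExpr_eq {atoms : List (RelAtom S)} {a : RelAtom S} {x : Var} (ha : a ∈ atoms)
    (hx : x ∈ a.vars) : ∃ (j k : ℕ) (a : RelAtom S), atoms[j]? = some a ∧ a.vars[k]? = some x ∧
      (occExpr atoms x : Expr D Rel) = argExpr j k := by
  obtain ⟨j, hj⟩ := List.mem_iff_getElem?.1 ha
  obtain ⟨k, hk⟩ := List.mem_iff_getElem?.1 hx
  have h : ∃ p : ℕ × ℕ, ∃ a, atoms[p.1]? = some a ∧ a.vars[p.2]? = some x := ⟨(j, k), a, hj, hk⟩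
  obtain ⟨b, hb, hb'⟩ := h.choose_spec
  exact ⟨_, _, b, hb, hb', by rw [occExpr, dif_pos h]⟩

def Test.conj : List (Test D Rel) → Test D Rel
  | [] => .isNil .nil
  | b :: bs => .and b (Test.conj bs)

theorem Test.holds_conj {bs : List (Test D Rel)} :
    (Test.conj bs).Holds σ ↔ ∀ b ∈ bs, b.Holds σ := by
  induction bs with
  | nil => simp [conj, Holds, Expr.eval]
  | cons b bs ih => simp [conj, Holds, ih]

theorem Test.exists_cost_conj_le {p : (ℕ → Val D Rel) → Prop} {bs : List (Test D Rel)}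
    (h : ∀ b ∈ bs, ∃ C, ∀ σ, p σ → b.cost σ ≤ C) : ∃ C, ∀ σ, p σ → (Test.conj bs).cost σ ≤ C := by
  induction bs with
  | nil => exact ⟨2, fun σ _ => by simp [conj, cost, Expr.cost]⟩
  | cons b bs ih =>
    obtain ⟨C₁, h₁⟩ := h b (by simp)
    obtain ⟨C₂, h₂⟩ := ih fun b hb => h b (by simp [hb])
    refine ⟨C₁ + C₂ + 1, fun σ hσ => ?_⟩
    have := h₁ σ hσ
    have := h₂ σ hσ
    simp only [conj, cost]
    omega

def Term.toExpr (occ : Var → Expr D Rel) : Term D → Expr D Rel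
  | .var x => occ x
  | .const c => .const c

def Formula.toTest (occ : Var → Expr D Rel) : Formula D → Test D Rel
  | .tru => .isNil .nil
  | .cmp op s t => .cmp op (s.toExpr occ) (t.toExpr occ)
  | .not φ => .not (φ.toTest occ)
  | .and φ ψ => .and (φ.toTest occ) (ψ.toTest occ)
  | .or φ ψ => .or (φ.toTest occ) (ψ.toTest occ)

theorem Term.eval_toExpr {occ : Var → Expr D Rel} {t : Term D}
    (h : ∀ x, t.HasVar x → (occ x).eval σ = .const (ρ x)) :
    (t.toExpr occ).eval σ = .const (t.eval ρ) := by
  cases t with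
  | var x => exact h x rfl
  | const c => rfl

theorem Formula.holds_toTest {occ : Var → Expr D Rel} {φ : Formula D}
    (h : ∀ x, φ.HasVar x → (occ x).eval σ = .const (ρ x)) :
    (φ.toTest occ).Holds σ ↔ φ.Holds ρ := by
  induction φ with
  | tru => simp [toTest, Test.Holds, Holds, Expr.eval]
  | cmp op s t =>
    rw [toTest, Test.Holds, Term.eval_toExpr fun x hx => h x (.inl hx),
      Term.eval_toExpr fun x hx => h x (.inr hx)]
    simp [Holds]
  | not φ ih => rw [toTest, Test.Holds, ih h, Holds]
  | and φ ψ ih₁ ih₂ =>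
    rw [toTest, Test.Holds, ih₁ fun x hx => h x (.inl hx), ih₂ fun x hx => h x (.inr hx), Holds]
  | or φ ψ ih₁ ih₂ =>
    rw [toTest, Test.Holds, ih₁ fun x hx => h x (.inl hx), ih₂ fun x hx => h x (.inr hx), Holds]

/-- Conditions translate without `Test.same`, the only test whose cost depends on the registers. -/
theorem Formula.exists_cost_toTest_le (occ : Var → Expr D Rel) (φ : Formula D) :
    ∃ C, ∀ σ, (φ.toTest occ).cost σ ≤ C := by
  induction φ with
  | tru => exact ⟨_, fun σ => le_rfl⟩
  | cmp op s t => exact ⟨_, fun σ => le_rfl⟩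
  | not φ ih =>
    obtain ⟨C, h⟩ := ih
    exact ⟨C + 1, fun σ => Nat.succ_le_succ (h σ)⟩
  | and φ ψ ih₁ ih₂ =>
    obtain ⟨C₁, h₁⟩ := ih₁
    obtain ⟨C₂, h₂⟩ := ih₂
    exact ⟨C₁ + C₂ + 1, fun σ => Nat.succ_le_succ (add_le_add (h₁ σ) (h₂ σ))⟩
  | or φ ψ ih₁ ih₂ =>
    obtain ⟨C₁, h₁⟩ := ih₁
    obtain ⟨C₂, h₂⟩ := ih₂
    exact ⟨C₁ + C₂ + 1, fun σ => Nat.succ_le_succ (add_le_add (h₁ σ) (h₂ σ))⟩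

/-- Tests whether the fact at the head of register `20 + j` is an instance of the atom `a`, under
the substitution that is given by `occ`. -/
def RelAtom.toTest (occ : Var → Expr D Rel) (a : RelAtom S) (j : ℕ) : Test D Rel :=
  .and (.same (.hd (.hd (.reg (20 + j)))) (.rel a.rel))
    (.conj (a.vars.zipIdx.map fun q => .cmp .eq (argExpr j q.2) (occ q.1)))

/-- Once the relation names agree, typing forces equal lengths, so comparing arguments at the
positions of the variables suffices. -/
theorem RelAtom.holds_toTest {occ : Var → Expr D Rel} {a : RelAtom S} {j : ℕ}
    (h : (σ (20 + j)).hd = (g j).encode) :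
    (a.toTest occ j).Holds σ ↔ (g j).rel = a.rel ∧
      ∀ (k : ℕ) x, a.vars[k]? = some x → ∃ c, (g j).args[k]? = some c ∧ (occ x).eval σ = .const c := by
  have hrel : (Test.same (.hd (.hd (.reg (20 + j)))) (.rel a.rel)).Holds σ ↔
      (g j).rel = a.rel := by
    simp [Test.Holds, Expr.eval, h, DBFact.encode]
  rw [toTest, Test.Holds, hrel, and_congr_right_iff]
  intro hr
  have hlen : (g j).args.length = a.vars.length := by
    rw [← List.length_map (f := Const.kind), (g j).typed, hr, ← a.typed, List.length_map]
  simp only [Test.holds_conj, List.mem_map, Prod.exists, List.mem_zipIdx_iff_getElem?]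
  constructor
  · intro hall k x hx
    have hk : k < (g j).args.length := by
      rw [hlen]; exact (List.getElem?_eq_some_iff.1 hx).1
    obtain ⟨c, d, h1, h2, h3⟩ := hall _ ⟨x, k, hx, rfl⟩
    rw [eval_argExpr h hk, Val.const.injEq] at h1
    have hcd : c = d := h3
    exact ⟨c, by rw [List.getElem?_eq_getElem hk, h1], by rw [h2, hcd]⟩
  · rintro hall _ ⟨x, k, hx, rfl⟩
    obtain ⟨c, h1, h2⟩ := hall k x hx
    obtain ⟨hk, h1⟩ := List.getElem?_eq_some_iff.1 h1
    exact ⟨c, c, by rw [eval_argExpr h hk, h1], h2, rfl⟩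

/-- Tests whether the facts at the heads of the registers from `20` on violate the constraint. -/
noncomputable def DenialConstraint.toTest (c : DenialConstraint D S) : Test D Rel :=
  .and (.conj (c.atoms.zipIdx.map fun q => q.1.toTest (occExpr c.atoms) q.2))
    (c.cond.toTest (occExpr c.atoms))

/-- The facts `g 0, g 1, …` violate the constraint. -/
def DenialConstraint.ViolatedBy (c : DenialConstraint D S) (g : ℕ → DBFact D S) : Prop :=
  ∃ ρ : Var → Const D, (∀ (j : ℕ) a, c.atoms[j]? = some a → a.Matches ρ (g j)) ∧ c.cond.Holds ρ

/-- The test compares every argument with one selected occurrence of its variable, so on success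
these occurrences define the substitution. Safety ensures that they cover the variables of the
condition. -/
theorem DenialConstraint.holds_toTest {c : DenialConstraint D S}
    (h : Loaded c.atoms.length g σ) : c.toTest.Holds σ ↔ c.ViolatedBy g := by
  have hload : ∀ (j : ℕ) a, c.atoms[j]? = some a → (σ (20 + j)).hd = (g j).encode := fun j a hj =>
    h j (List.getElem?_eq_some_iff.1 hj).1
  have hatoms : (Test.conj (c.atoms.zipIdx.map fun q =>
      q.1.toTest (occExpr c.atoms) q.2)).Holds σ ↔ ∀ (j : ℕ) a, c.atoms[j]? = some a →
        (g j).rel = a.rel ∧ ∀ (k : ℕ) x, a.vars[k]? = some x →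
          ∃ d, (g j).args[k]? = some d ∧ (occExpr c.atoms x).eval σ = .const d := by
    simp only [Test.holds_conj, List.mem_map, Prod.exists, List.mem_zipIdx_iff_getElem?]
    constructor
    · intro hall j a hj
      exact (RelAtom.holds_toTest (hload j a hj)).1 (hall _ ⟨a, j, hj, rfl⟩)
    · rintro hall _ ⟨a, j, hj, rfl⟩
      exact (RelAtom.holds_toTest (hload j a hj)).2 (hall j a hj)
  rw [toTest, Test.Holds, hatoms]
  constructor
  · rintro ⟨hall, hcond⟩
    -- The default `.num 0` only concerns variables whose expression does not yield a constant; none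
    -- of these occurs in the constraint.
    let ρ : Var → Const D := fun x =>
      match (occExpr c.atoms x : Expr D Rel).eval σ with
      | .const d => d
      | _ => .num 0
    have hρ : ∀ x d, (occExpr c.atoms x : Expr D Rel).eval σ = .const d → ρ x = d := by
      intro x d hx
      simp only [ρ, hx]
    refine ⟨ρ, fun j a hj => ⟨(hall j a hj).1, ?_⟩, (Formula.holds_toTest fun x hx => ?_).1 hcond⟩
    · obtain ⟨hr, hargs⟩ := hall j a hj
      have hlen : (g j).args.length = a.vars.length := by
        rw [← List.length_map (f := Const.kind), (g j).typed, hr, ← a.typed, List.length_map]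
      refine List.ext_getElem (by simpa using hlen) fun k h1 h2 => ?_
      obtain ⟨d, hd, hd'⟩ := hargs k _ (List.getElem?_eq_getElem (hlen ▸ h1))
      rw [List.getElem_map, hρ _ _ hd']
      exact (List.getElem?_eq_some_iff.1 hd).2
    · obtain ⟨a, ha, hxa⟩ := c.safe x hx
      obtain ⟨j, hj⟩ := List.mem_iff_getElem?.1 ha
      obtain ⟨k, hk⟩ := List.mem_iff_getElem?.1 hxa
      obtain ⟨d, -, hd⟩ := (hall j a hj).2 k x hk
      rw [hd, hρ x d hd]
  · rintro ⟨ρ, hall, hcond⟩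
    have hocc : ∀ a ∈ c.atoms, ∀ x ∈ a.vars,
        (occExpr c.atoms x : Expr D Rel).eval σ = .const (ρ x) := by
      intro a ha x hx
      obtain ⟨j, k, b, hb, hb', he⟩ := occExpr_eq (D := D) ha hx
      obtain ⟨hk, hkx⟩ := List.getElem?_eq_some_iff.1 hb'
      have hargs := (hall j b hb).2
      rw [he, eval_argExpr (hload j b hb) (by rw [hargs]; simpa using hk)]
      simp [hargs, hkx]
    refine ⟨fun j a hj => ⟨(hall j a hj).1, fun k x hx => ⟨ρ x, ?_, ?_⟩⟩,
      (Formula.holds_toTest fun x hx => ?_).2 hcond⟩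
    · rw [(hall j a hj).2, List.getElem?_map, hx, Option.map_some]
    · exact hocc a (List.mem_of_getElem? hj) x (List.mem_of_getElem? hx)
    · obtain ⟨a, ha, hxa⟩ := c.safe x hx
      exact hocc a ha x hxa

theorem DenialConstraint.exists_cost_toTest_le (c : DenialConstraint D S) :
    ∃ C, ∀ (g : ℕ → DBFact D S) σ, Loaded c.atoms.length g σ → c.toTest.cost σ ≤ C := by
  obtain ⟨C₁, h₁⟩ := Test.exists_cost_conj_le
    (p := fun σ => ∃ g : ℕ → DBFact D S, Loaded c.atoms.length g σ)
    (bs := c.atoms.zipIdx.map fun q => q.1.toTest (occExpr c.atoms) q.2) (by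
      simp only [List.mem_map, Prod.exists, List.mem_zipIdx_iff_getElem?]
      rintro _ ⟨a, j, hj, rfl⟩
      obtain ⟨C, hC⟩ := Test.exists_cost_conj_le (p := fun _ => True)
        (bs := a.vars.zipIdx.map fun q =>
          .cmp .eq (argExpr j q.2) (occExpr (D := D) c.atoms q.1)) (by
          simp only [List.mem_map]
          rintro _ ⟨q, -, rfl⟩
          exact ⟨_, fun _ _ => le_rfl⟩)
      -- The `same` test costs `7`, because both sides are single cells holding relation names; the
      -- conjunction adds `1`.
      refine ⟨C + 8, ?_⟩
      rintro σ ⟨g, hg⟩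
      have := hC σ trivial
      have h := hg j (List.getElem?_eq_some_iff.1 hj).1
      have hrel : (σ (20 + j)).hd.hd = .rel (g j).rel := by rw [h]; rfl
      simp only [RelAtom.toTest, Test.cost, Expr.cost, Expr.eval, hrel, Val.size]
      omega)
  obtain ⟨C₂, h₂⟩ := c.cond.exists_cost_toTest_le (occExpr (D := D) c.atoms)
  exact ⟨C₁ + C₂ + 1, fun g σ h => Nat.succ_le_succ (add_le_add (h₁ σ ⟨g, h⟩) (h₂ σ))⟩

/-- Pinning `g` to `g₀` beyond the atoms gives exactly the form in which `ensures_searchTuples`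
reports its result. -/
theorem DenialConstraint.not_sat_iff {c : DenialConstraint D S} {l : List (DBFact D S)}
    (g₀ : ℕ → DBFact D S) : ¬ c.Sat {x | x ∈ l} ↔
      ∃ g : ℕ → DBFact D S, (∀ j ≥ c.atoms.length, g j = g₀ j) ∧
        (∀ j < c.atoms.length, g j ∈ l) ∧ c.ViolatedBy g := by
  simp only [Sat, not_forall, not_not]
  constructor
  · rintro ⟨ρ, h, hc⟩
    have : ∀ j, ∃ f, (c.atoms.length ≤ j → f = g₀ j) ∧
        ∀ a, c.atoms[j]? = some a → f ∈ l ∧ a.Matches ρ f := by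
      intro j
      cases hj : c.atoms[j]? with
      | none => exact ⟨g₀ j, by simp⟩
      | some a =>
        obtain ⟨f, hf, hm⟩ := h a (List.mem_of_getElem? hj)
        refine ⟨f, fun hle => ?_, ?_⟩
        · rw [List.getElem?_eq_none hle] at hj
          cases hj
        · rintro _ ⟨⟩
          exact ⟨hf, hm⟩
    choose g h1 h2 using this
    exact ⟨g, h1, fun j hj => (h2 j _ (List.getElem?_eq_getElem hj)).1, ρ,
      fun j a hj => (h2 j a hj).2, hc⟩
  · rintro ⟨g, -, h1, ρ, h2, hc⟩
    refine ⟨ρ, fun a ha => ?_, hc⟩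
    obtain ⟨j, hj⟩ := List.mem_iff_getElem?.1 ha
    exact ⟨g j, h1 j (List.getElem?_eq_some_iff.1 hj).1, h2 j a hj⟩

/-! ### Testing consistency -/

/-- Raise the flag in register `11` if the test succeeds for some choice of `n` facts of the list
in register `12`, held by the registers `20, …, 20 + n - 1`. -/
def searchTuples (b : Test D Rel) : ℕ → Cmd D Rel
  | 0 => .ite b (.assign 11 (.cons .nil .nil)) .skip
  | n + 1 => .forEach (20 + n) (.reg 12) (searchTuples b n)

theorem writes_searchTuples {b : Test D Rel} {n k : ℕ} (h : (searchTuples b n).Writes k) :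
    k = 11 ∨ 20 ≤ k ∧ k < 20 + n := by
  induction n with
  | zero => simp_all [searchTuples, Cmd.Writes]
  | succ n ih =>
    rw [searchTuples, Cmd.writes_forEach] at h
    rcases h with rfl | h
    · omega
    · have := ih h; omega

/-- Induction on the nesting depth: the outer registers already hold `g`, and each additional loop
multiplies the bound by about `N`. The degree of `p` thus depends only on the number of atoms. -/
theorem ensures_searchTuples {b : Test D Rel} {M C : ℕ} {φ : (ℕ → DBFact D S) → Prop}
    (hφ : ∀ g σ, Loaded M g σ → (b.Holds σ ↔ φ g))
    (hC : ∀ (g : ℕ → DBFact D S) σ, Loaded M g σ → b.cost σ ≤ C) (n : ℕ) (hn : n ≤ M) :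
    ∃ p : Polynomial ℕ, ∀ m σ (g : ℕ → DBFact D S) l N, σ 12 = encodeFacts l → l.length ≤ N →
      (∀ j < M, n ≤ j → (σ (20 + j)).hd = (g j).encode) →
      Ensures m (searchTuples b n) σ (p.eval N) (fun τ => τ 11 ≠ .nil ↔ σ 11 ≠ .nil ∨
        ∃ g' : ℕ → DBFact D S, (∀ j ≥ n, g' j = g j) ∧ (∀ j < n, g' j ∈ l) ∧ φ g') := by
  induction n with
  | zero =>
    refine ⟨.C (C + 5), fun m σ g l N _ _ hg => ?_⟩
    have hload : Loaded M g σ := fun j hj => hg j hj (Nat.zero_le j)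
    have hiff : (∃ g' : ℕ → DBFact D S, (∀ j ≥ 0, g' j = g j) ∧ (∀ j < 0, g' j ∈ l) ∧ φ g') ↔
        φ g := by
      constructor
      · rintro ⟨g', h, -, h'⟩
        rwa [← funext fun j => h j (Nat.zero_le j)]
      · exact fun h => ⟨g, by simp, by simp, h⟩
    simp only [hiff, Polynomial.eval_C]
    have hcost := hC g σ hload
    refine .ite (T₁ := 4) (fun hb => .assign (by simp [Expr.cost]) ?_)
      (fun hb => .skip (by simp) ?_) (by omega)
    · simp [Expr.eval, (hφ g σ hload).1 hb]
    · simp [mt (hφ g σ hload).2 hb]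
  | succ n ih =>
    obtain ⟨p, hp⟩ := ih (by omega)
    refine ⟨.X * (p + 8) + 7, fun m σ g l N hl hN hg => ?_⟩
    refine (Ensures.search (σ := σ) (src := .reg 12) (body := searchTuples b n)
      (enc := DBFact.encode) (l := l) (N := N) (T := p.eval N) (k := 11)
      (φ := fun a => ∃ g' : ℕ → DBFact D S, (∀ j ≥ n, g' j = Function.update g n a j) ∧
        (∀ j < n, g' j ∈ l) ∧ φ g') hl hN (fun h => ?_) (by omega) ?_).mono ?_ ?_
    · have := writes_searchTuples h; omega
    · intro a ha τ hτ hfr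
      refine hp m τ (Function.update g n a) l N ?_ hN fun j hj hnj => ?_
      · rw [hfr 12 (by omega) fun h => by have := writes_searchTuples h; omega, hl]
      · rcases hnj.eq_or_lt with rfl | hlt
        · simpa using hτ
        · rw [hfr (20 + j) (by omega) fun h => by have := writes_searchTuples h; omega,
            hg j hj hlt, Function.update_of_ne (by omega)]
    · simp [Expr.cost]
    · intro τ hτ
      rw [hτ]
      refine or_congr_right ⟨?_, ?_⟩
      · rintro ⟨a, ha, g', h1, h2, h3⟩
        refine ⟨g', fun j hj => ?_, fun j hj => ?_, h3⟩
        · rw [h1 j (by omega), Function.update_of_ne (by omega)]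
        · rcases (Nat.lt_succ_iff.1 hj).eq_or_lt with rfl | hlt
          · rwa [h1 j le_rfl, Function.update_self]
          · exact h2 j hlt
      · rintro ⟨g', h1, h2, h3⟩
        refine ⟨g' n, h2 n (by omega), g', fun j hj => ?_, fun j hj => h2 j (by omega), h3⟩
        rcases hj.eq_or_lt with rfl | hlt
        · simp
        · rw [Function.update_of_ne (by omega), h1 j (by omega)]

/-- Raise the flag in register `11` if the list of facts in register `12` violates one of the
constraints. -/
noncomputable def checkCmd : List (DenialConstraint D S) → Cmd D Rel
  | [] => .skip
  | c :: cs => .seq (searchTuples c.toTest c.atoms.length) (checkCmd cs)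

theorem writes_checkCmd {cs : List (DenialConstraint D S)} {k : ℕ}
    (h : (checkCmd cs).Writes k) : k = 11 ∨ 20 ≤ k := by
  induction cs with
  | nil => exact h.elim
  | cons c cs ih =>
    rcases h with h | h
    · have := writes_searchTuples h; omega
    · exact ih h

theorem ensures_checkCmd (cs : List (DenialConstraint D S)) :
    ∃ p : Polynomial ℕ, ∀ m σ l N, σ 12 = encodeFacts l → l.length ≤ N → l ≠ [] →
      Ensures m (checkCmd cs) σ (p.eval N) (fun τ => τ 11 ≠ .nil ↔ σ 11 ≠ .nil ∨
        ∃ c ∈ cs, ¬ c.Sat {x | x ∈ l}) := by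
  induction cs with
  | nil => exact ⟨1, fun m σ l N _ _ _ => .skip (by simp) (by simp)⟩
  | cons c cs ih =>
    obtain ⟨p, hp⟩ := ih
    obtain ⟨C, hC⟩ := c.exists_cost_toTest_le
    obtain ⟨q, hq⟩ := ensures_searchTuples (fun g σ => c.holds_toTest) hC _ le_rfl
    refine ⟨q + p + 1, fun m σ l N hl hN hne => ?_⟩
    -- An arbitrary fact serves as filler for the positions beyond the atoms.
    obtain ⟨f, -⟩ := List.exists_mem_of_ne_nil l hne
    refine .seq (hq m σ (fun _ => f) l N hl hN fun j h1 h2 => by omega).frame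
      (T₂ := p.eval N) (fun τ hτ => ?_) (by simp)
    refine (hp m τ l N ?_ hN hne).mono le_rfl fun τ' hτ' => ?_
    · rw [hτ.2 12 fun h => by have := writes_searchTuples h; omega, hl]
    · rw [hτ', hτ.1, ← c.not_sat_iff]
      simp [or_assoc]

end Check

section Program

variable {D : Type u} {Rel : Type v} {S : Schema Rel}

/-! ### Encodings -/

theorem Val.ofList_injective : Function.Injective (Val.ofList : List (Val D Rel) → Val D Rel) := by
  intro l
  induction l with
  | nil => rintro (_ | ⟨a, l⟩) h <;> simp_all [Val.ofList]
  | cons a l ih =>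
    rintro (_ | ⟨b, l'⟩) h
    · simp [Val.ofList] at h
    · simp only [Val.ofList, Val.cons.injEq] at h
      rw [h.1, ih h.2]

theorem DBFact.encode_injective :
    Function.Injective (DBFact.encode : DBFact D S → Val D Rel) := by
  intro f g h
  simp only [encode, Val.cons.injEq, Val.rel.injEq] at h
  exact eq_of_rel_args h.1
    (List.map_injective_iff.2 (fun a b h => by simpa using h) (Val.ofList_injective h.2))

theorem DBFact.encode_ne_nil (f : DBFact D S) : f.encode ≠ (.nil : Val D Rel) := by
  simp [encode]

theorem Val.length_le_size_ofList (l : List (Val D Rel)) : l.length ≤ (Val.ofList l).size := by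
  induction l with
  | nil => simp
  | cons a l ih => simp only [List.length_cons, Val.ofList, Val.size]; omega

theorem Val.size_le_size_ofList {a : Val D Rel} {l : List (Val D Rel)} (h : a ∈ l) :
    a.size ≤ (Val.ofList l).size := by
  induction l with
  | nil => simp at h
  | cons b l ih =>
    simp only [Val.ofList, Val.size]
    rcases List.mem_cons.1 h with rfl | h
    · omega
    · have := ih h; omega

/-! ### Derived rules -/

theorem Ensures.assign_seq {m : Bool} {n : ℕ} {e : Expr D Rel} {c : Cmd D Rel}
    {σ : ℕ → Val D Rel} {T T₁ : ℕ} {Q : (ℕ → Val D Rel) → Prop}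
    (h : Ensures m c (Function.update σ n (e.eval σ)) T₁ Q) (hT : T₁ + e.cost + 2 ≤ T) :
    Ensures m (.seq (.assign n e) c) σ T Q :=
  .seq (.assign (T := e.cost + 1) le_rfl (Q := fun τ => τ = _) rfl)
    (by rintro τ rfl; exact h) (by omega)

theorem Ensures.seq_frame {m : Bool} {c₁ c₂ : Cmd D Rel} {σ : ℕ → Val D Rel} {T T₁ T₂ : ℕ}
    {Q₁ Q : (ℕ → Val D Rel) → Prop} (h₁ : Ensures m c₁ σ T₁ Q₁)
    (h₂ : ∀ τ, Q₁ τ → (∀ n, ¬ c₁.Writes n → τ n = σ n) → Ensures m c₂ τ T₂ Q)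
    (hT : T₁ + T₂ + 1 ≤ T) : Ensures m (.seq c₁ c₂) σ T Q :=
  .seq h₁.frame (fun τ hτ => h₂ τ hτ.1 hτ.2) hT

/-! ### The program

Register `1` holds the remaining facts, `2` the pairs of the priority, `3` the choices made so far,
the last one first, `4` the facts kept so far, and `5` the current choice. -/

/-- Raise the flag in register `7` if the fact at the head of register `6` is dominated by one of
the remaining facts. -/
def dominatedCmd : Cmd D Rel :=
  .forEach 8 (.reg 2)
    (.ite (.same (.tl (.hd (.reg 8))) (.hd (.reg 6)))
      (.forEach 9 (.reg 1)
        (.ite (.same (.hd (.hd (.reg 8))) (.hd (.reg 9))) (.assign 7 (.cons .nil .nil)) .skip))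
      .skip)

/-- Consider the fact at the head of register `6` as the next choice: take it if it is undominated,
unless an earlier choice is preferred. -/
def considerCmd : Cmd D Rel :=
  .seq (.assign 7 .nil)
    (.seq dominatedCmd
      (.ite (.isNil (.reg 7))
        (.ite (.isNil (.reg 5)) (.assign 5 (.hd (.reg 6)))
          (.choose (.assign 5 (.hd (.reg 6))) .skip))
        .skip))

/-- Choose an undominated remaining fact. -/
def pickCmd : Cmd D Rel :=
  .seq (.assign 5 .nil) (.forEach 6 (.reg 1) considerCmd)

/-- Remove the chosen fact from the remaining ones. -/
def removeCmd : Cmd D Rel :=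
  .seq (.assign 10 .nil)
    (.seq
      (.forEach 6 (.reg 1)
        (.ite (.same (.hd (.reg 6)) (.reg 5)) .skip
          (.assign 10 (.cons (.hd (.reg 6)) (.reg 10)))))
      (.assign 1 (.reg 10)))

/-- Keep the chosen fact if it is consistent with those kept so far. -/
noncomputable def keepCmd (cs : List (DenialConstraint D S)) : Cmd D Rel :=
  .seq (.assign 12 (.cons (.reg 5) (.reg 4)))
    (.seq (.assign 11 .nil)
      (.seq (checkCmd cs)
        (.ite (.isNil (.reg 11)) (.assign 4 (.reg 12)) .skip)))

noncomputable def stepCmd (cs : List (DenialConstraint D S)) : Cmd D Rel :=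
  .seq pickCmd (.seq removeCmd (.seq (keepCmd cs) (.assign 3 (.cons (.reg 5) (.reg 3)))))

noncomputable def greedyCmd (cs : List (DenialConstraint D S)) : Cmd D Rel :=
  .seq (.assign 1 (.hd (.reg 0)))
    (.seq (.assign 2 (.tl (.reg 0)))
      (.seq (.loop (.not (.isNil (.reg 1))) (stepCmd cs))
        (.seq (.assign 10 .nil)
          (.seq (.forEach 6 (.reg 3) (.assign 10 (.cons (.hd (.reg 6)) (.reg 10))))
            (.assign 0 (.cons (.reg 10) (.reg 4)))))))

theorem writes_dominatedCmd {n : ℕ} (h : (dominatedCmd : Cmd D Rel).Writes n) :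
    n = 7 ∨ n = 8 ∨ n = 9 := by
  simp only [dominatedCmd, Cmd.writes_forEach, Cmd.Writes, or_false] at h
  omega

theorem writes_considerCmd {n : ℕ} (h : (considerCmd : Cmd D Rel).Writes n) :
    n = 5 ∨ n = 7 ∨ n = 8 ∨ n = 9 := by
  simp only [considerCmd, Cmd.Writes, or_false] at h
  rcases h with h | h | h
  any_goals omega
  have := writes_dominatedCmd h
  omega

theorem writes_pickCmd {n : ℕ} (h : (pickCmd : Cmd D Rel).Writes n) : 5 ≤ n ∧ n ≤ 9 := by
  rw [pickCmd, Cmd.Writes, Cmd.writes_forEach] at h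
  rcases h with h | h | h
  · cases h; omega
  · omega
  · have := writes_considerCmd h
    omega

theorem writes_removeCmd {n : ℕ} (h : (removeCmd : Cmd D Rel).Writes n) :
    n = 1 ∨ n = 6 ∨ n = 10 := by
  simp only [removeCmd, Cmd.writes_forEach, Cmd.Writes, false_or] at h
  omega

theorem writes_keepCmd {cs : List (DenialConstraint D S)} {n : ℕ}
    (h : (keepCmd cs).Writes n) : n = 4 ∨ 11 ≤ n := by
  simp only [keepCmd, Cmd.Writes, or_false] at h
  rcases h with h | h | h | h
  any_goals omega
  have := writes_checkCmd h
  omega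

/-! ### Specifications of the subroutines -/

theorem ensures_dominatedCmd : ∃ p : Polynomial ℕ, ∀ m (σ : ℕ → Val D Rel) N
    (lA : List (DBFact D S)) (lr : List (DBFact D S × DBFact D S)) (f : DBFact D S),
    σ 1 = encodeFacts lA → σ 2 = encodePairs lr → (σ 6).hd = f.encode →
    lA.length ≤ N → lr.length ≤ N → (∀ x ∈ lA, (x.encode : Val D Rel).size ≤ N) →
    (∀ p ∈ lr, (p.1.encode : Val D Rel).size ≤ N ∧ (p.2.encode : Val D Rel).size ≤ N) →
    (f.encode : Val D Rel).size ≤ N →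
    Ensures m dominatedCmd σ (p.eval N) (fun τ => τ 7 ≠ .nil ↔ σ 7 ≠ .nil ∨
      ∃ p ∈ lr, p.2 = f ∧ p.1 ∈ lA) := by
  -- Two nested searches, each iteration comparing two encoded facts of size at most `N`; this
  -- accounts for each `2 * .X`.
  refine ⟨.X * (2 * .X + 7 + (.X * (2 * .X + 11 + 8) + 7) + 8) + 7, ?_⟩
  intro m σ N lA lr f h1 h2 h6 hlA hlr hsA hsr hsf
  unfold dominatedCmd
  refine Ensures.mono (Ensures.search (N := N) (T := 2 * N + 7 + (N * (2 * N + 11 + 8) + 7))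
    (enc := fun p => .cons p.1.encode p.2.encode) (k := 7) (φ := fun p => p.2 = f ∧ p.1 ∈ lA)
    (by exact h2) hlr (by simp [Cmd.writes_forEach, Cmd.Writes]) (by decide) ?_)
    (by simp [Expr.cost]) (fun τ hτ => hτ)
  intro p hp τ hτ8 hfr
  have hτ1 : τ 1 = σ 1 := hfr 1 (by decide) (by simp [Cmd.writes_forEach, Cmd.Writes])
  have hτ6 : τ 6 = σ 6 := hfr 6 (by decide) (by simp [Cmd.writes_forEach, Cmd.Writes])
  have htest : (Test.same (.tl (.hd (.reg 8))) (.hd (.reg 6)) : Test D Rel).Holds τ ↔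
      p.2 = f := by
    simp only [Test.Holds, Expr.eval, hτ8, hτ6, h6, Val.tl_cons]
    exact DBFact.encode_injective.eq_iff
  refine .ite (T₁ := N * (2 * N + 11 + 8) + 7) (fun hb => ?_) (fun hb => ?_) ?_
  · refine Ensures.mono (Ensures.search (N := N) (T := 2 * N + 11) (enc := DBFact.encode) (k := 7)
      (φ := fun a => p.1 = a) (by exact hτ1.trans h1) hlA (by simp [Cmd.Writes]) (by decide) ?_)
      (by simp [Expr.cost]) (fun τ' hτ' => ?_)
    · intro a ha τ' hτ9 hfr'
      have hτ8' : τ' 8 = τ 8 := hfr' 8 (by decide) (by simp [Cmd.Writes])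
      have htest' : (Test.same (.hd (.hd (.reg 8))) (.hd (.reg 9)) : Test D Rel).Holds τ' ↔
          p.1 = a := by
        simp only [Test.Holds, Expr.eval, hτ8', hτ8, hτ9, Val.hd_cons]
        exact DBFact.encode_injective.eq_iff
      refine .ite (T₁ := 4) (fun hb => .assign (by simp [Expr.cost]) ?_)
        (fun hb => .skip (by simp) ?_) ?_
      · simp [Expr.eval, htest'.1 hb]
      · simp [mt htest'.2 hb]
      · simp only [Test.cost, Expr.cost, Expr.eval, hτ8', hτ8, hτ9, Val.hd_cons]
        have := (hsr p hp).1
        have := hsA a ha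
        omega
    · rw [hτ']
      simp [htest.1 hb]
  · refine .skip (by omega) ?_
    simp [mt htest.2 hb]
  · simp only [Test.cost, Expr.cost, Expr.eval, hτ8, hτ6, h6, Val.tl_cons]
    have := (hsr p hp).2
    omega

/-- The fact `x₀` witnesses that something can be picked and, for `m = true`, is the fact to be
picked: the run takes it when it comes up and declines every later replacement. -/
theorem ensures_pickCmd : ∃ p : Polynomial ℕ, ∀ m (σ : ℕ → Val D Rel) N
    (lA : List (DBFact D S)) (lr : List (DBFact D S × DBFact D S)) (x₀ : DBFact D S),
    σ 1 = encodeFacts lA → σ 2 = encodePairs lr →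
    lA.length ≤ N → lr.length ≤ N → (∀ x ∈ lA, (x.encode : Val D Rel).size ≤ N) →
    (∀ p ∈ lr, (p.1.encode : Val D Rel).size ≤ N ∧ (p.2.encode : Val D Rel).size ≤ N) →
    x₀ ∈ winnow (fun x y => (x, y) ∈ lr) {x | x ∈ lA} →
    Ensures m pickCmd σ (p.eval N) (fun τ =>
      ∃ x ∈ winnow (fun x y => (x, y) ∈ lr) {x | x ∈ lA}, τ 5 = x.encode ∧
        (m = true → x = x₀)) := by
  obtain ⟨p, hp⟩ := ensures_dominatedCmd (D := D) (S := S)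
  refine ⟨.X * (p + 14 + 8) + 10, ?_⟩
  intro m σ N lA lr x₀ h1 h2 hlA hlr hsA hsr hx₀
  set W := winnow (fun x y => (x, y) ∈ lr) {x | x ∈ lA} with hW
  refine Ensures.assign_seq (T₁ := N * (p.eval N + 14 + 8) + 7) ?_ (by simp [Expr.cost])
  refine (Ensures.forEach (N := N) (T := p.eval N + 14) (l := lA) (enc := DBFact.encode)
    -- Register `5` stays empty until the first undominated fact, which is taken without a choice;
    -- in the favourable mode it holds `x₀` once `x₀` has been passed.
    (Inv := fun pre τ => (τ 5 = .nil ∧ ∀ x ∈ pre, x ∉ W) ∨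
      ∃ x ∈ pre, x ∈ W ∧ τ 5 = x.encode ∧ (m = true → x₀ ∈ pre → x = x₀))
    (by simpa [Expr.eval, encodeFacts] using h1) hlA ?_ ?_ ?_).mono (by simp [Expr.cost]) ?_
  · exact fun h => by have := writes_considerCmd h; omega
  · simp [Expr.eval]
  · intro pre a post τ hl hτ6 hfr hinv
    have hτ1 : τ 1 = encodeFacts lA := by
      rw [hfr 1 (by decide), Function.update_of_ne (by decide), h1]
      exact fun h => by have := writes_considerCmd h; omega
    have hτ2 : τ 2 = encodePairs lr := by
      rw [hfr 2 (by decide), Function.update_of_ne (by decide), h2]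
      exact fun h => by have := writes_considerCmd h; omega
    have ha : a ∈ lA := by simp [hl]
    have hpost : ∀ x ∈ lA, x ∈ W ↔ ¬ ∃ p ∈ lr, p.2 = x ∧ p.1 ∈ lA := by
      intro x hx
      simp only [hW, winnow, Set.mem_ofPred_eq, hx, true_and]
      refine not_congr ⟨?_, ?_⟩
      · rintro ⟨y, hy, h⟩
        exact ⟨_, h, rfl, hy⟩
      · rintro ⟨⟨y, _⟩, h, rfl, hy⟩
        exact ⟨y, hy, h⟩
    refine Ensures.assign_seq (T₁ := p.eval N + 11) ?_ (by simp [Expr.cost])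
    refine Ensures.seq_frame (hp m _ N lA lr a (by simpa using hτ1) (by simpa using hτ2)
      (by simp [hτ6, Val.ofList]) hlA hlr hsA hsr (hsA a ha)) (T₂ := 10) ?_ (by omega)
    intro τ' hτ' hfr'
    have h5 : τ' 5 = τ 5 := by
      rw [hfr' 5 fun h => by have := writes_dominatedCmd h; omega]
      simp
    have h6 : (τ' 6).hd = a.encode := by
      rw [hfr' 6 fun h => by have := writes_dominatedCmd h; omega]
      simp [hτ6, Val.ofList]
    have h7 : τ' 7 = .nil ↔ a ∈ W := by
      rw [hpost a ha, ← not_iff_not, ← ne_eq, hτ']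
      simp [Expr.eval]
    refine .ite (T₁ := 7) (fun hb => ?_) (fun hb => .skip (by omega) ?_)
      (by simp [Test.cost, Expr.cost])
    · have haW := h7.1 hb
      refine .ite (T₁ := 4) (fun hb' => .assign (by simp [Expr.cost]) (.inr ⟨a, by simp, haW, ?_⟩))
        (fun hb' => ?_) (by simp [Test.cost, Expr.cost])
      · refine ⟨by simp [Expr.eval, h6], fun _ hx => ?_⟩
        rcases hinv with ⟨-, hinv⟩ | ⟨x, -, -, hx5, -⟩
        · rcases List.mem_append.1 hx with hx | hx
          · exact absurd hx₀ (hinv _ hx)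
          · simpa [eq_comm] using hx
        · exact absurd (hx5.symm.trans (h5.symm.trans hb')) (DBFact.encode_ne_nil x)
      · have hinv' : ∃ x ∈ pre, x ∈ W ∧ τ 5 = x.encode ∧ (m = true → x₀ ∈ pre → x = x₀) := by
          rcases hinv with ⟨h, -⟩ | h
          · exact absurd (h5.trans h) hb'
          · exact h
        obtain ⟨x, hx, hxW, hx5, hxm⟩ := hinv'
        have hleft : (m = true → a = x₀) → Ensures m (.assign 5 (.hd (.reg 6))) τ' 3
            (fun τ' => (Function.update τ' 6 (Val.ofList (post.map DBFact.encode)) 5 = .nil ∧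
              ∀ x ∈ pre ++ [a], x ∉ W) ∨ ∃ x ∈ pre ++ [a], x ∈ W ∧
              Function.update τ' 6 (Val.ofList (post.map DBFact.encode)) 5 = x.encode ∧
              (m = true → x₀ ∈ pre ++ [a] → x = x₀)) := fun hm =>
          .assign (by simp [Expr.cost]) (.inr ⟨a, by simp, haW, by simp [Expr.eval, h6],
            fun h _ => hm h⟩)
        have hright : (m = true → a ≠ x₀) → Ensures m .skip τ' 3
            (fun τ' => (Function.update τ' 6 (Val.ofList (post.map DBFact.encode)) 5 = .nil ∧
              ∀ x ∈ pre ++ [a], x ∉ W) ∨ ∃ x ∈ pre ++ [a], x ∈ W ∧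
              Function.update τ' 6 (Val.ofList (post.map DBFact.encode)) 5 = x.encode ∧
              (m = true → x₀ ∈ pre ++ [a] → x = x₀)) := fun hm =>
          .skip (by simp) (.inr ⟨x, by simp [hx], hxW, by simp [h5, hx5], fun h h' => by
            rcases List.mem_append.1 h' with h' | h'
            · exact hxm h h'
            · exact absurd (by simpa [eq_comm] using h') (hm h)⟩)
        cases m with
        | false => exact .choose (hleft (by simp)) (hright (by simp)) (by omega)
        | true =>
          by_cases hax : a = x₀
          · exact .choose_left rfl (hleft fun _ => hax) (by omega)
          · exact .choose_right rfl (hright fun _ => hax) (by omega)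
    · have haW : a ∉ W := fun h => hb (h7.2 h)
      rcases hinv with ⟨h, hinv⟩ | ⟨x, hx, hxW, hx5, hxm⟩
      · refine .inl ⟨by simp [h5, h], fun x hx => ?_⟩
        rcases List.mem_append.1 hx with hx | hx
        · exact hinv x hx
        · rwa [List.mem_singleton.1 hx]
      · refine .inr ⟨x, by simp [hx], hxW, by simp [h5, hx5], fun h h' => ?_⟩
        rcases List.mem_append.1 h' with h' | h'
        · exact hxm h h'
        · exact absurd (List.mem_singleton.1 h' ▸ hx₀) haW
  · rintro τ (⟨-, h⟩ | ⟨x, hx, hxW, hx5, hxm⟩)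
    · exact absurd hx₀ (h _ hx₀.1)
    · exact ⟨x, hxW, hx5, fun h => hxm h hx₀.1⟩

/-- The list is rebuilt in reverse, hence a permutation instead of an equality. As `lA` has no
repetitions, dropping every copy of `x` drops exactly one. -/
theorem ensures_removeCmd : ∃ p : Polynomial ℕ, ∀ m (σ : ℕ → Val D Rel) N
    (lA : List (DBFact D S)) (x : DBFact D S),
    σ 1 = encodeFacts lA → σ 5 = x.encode → lA.length ≤ N →
    (∀ x ∈ lA, (x.encode : Val D Rel).size ≤ N) → x ∈ lA → lA.Nodup →
    Ensures m removeCmd σ (p.eval N) (fun τ =>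
      ∃ lA', τ 1 = encodeFacts lA' ∧ (x :: lA').Perm lA) := by
  classical
  refine ⟨.X * (2 * .X + 10 + 8) + 13, ?_⟩
  intro m σ N lA x h1 h5 hlA hsA hx hnd
  refine Ensures.assign_seq (T₁ := N * (2 * N + 10 + 8) + 10) ?_ (by simp [Expr.cost])
  refine Ensures.seq_frame (Ensures.forEach (N := N) (T := 2 * N + 10) (l := lA)
    (enc := DBFact.encode)
    (Inv := fun pre τ => τ 10 = encodeFacts (pre.filter (· ≠ x)).reverse)
    (by simpa [Expr.eval, encodeFacts] using h1) hlA (by simp [Cmd.Writes]) ?_ ?_) (T₂ := 2) ?_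
    (by simp [Expr.cost])
  · simp [Expr.eval, encodeFacts, Val.ofList]
  · intro pre a post τ hl hτ6 hfr hinv
    have hτ5 : τ 5 = x.encode := by
      rw [hfr 5 (by decide) (by simp [Cmd.Writes]), Function.update_of_ne (by decide), h5]
    have ha : a ∈ lA := by simp [hl]
    have hhd : (τ 6).hd = a.encode := by simp [hτ6, Val.ofList]
    have htest : (Test.same (.hd (.reg 6)) (.reg 5) : Test D Rel).Holds τ ↔ a = x := by
      simp only [Test.Holds, Expr.eval, hτ5, hhd]
      exact DBFact.encode_injective.eq_iff
    refine .ite (T₁ := 5) (fun hb => .skip (by simp) ?_)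
      (fun hb => .assign (by simp [Expr.cost]) ?_) ?_
    · simpa [htest.1 hb] using hinv
    · have hax : a ≠ x := mt htest.2 hb
      simp only [Expr.eval, hhd, hinv]
      simp [hax, encodeFacts, Val.ofList]
    · simp only [Test.cost, Expr.cost, Expr.eval, hhd, hτ5]
      have := hsA a ha
      have := hsA x hx
      omega
  · intro τ hτ hfr
    refine .assign (by simp [Expr.cost])
      ⟨(lA.filter (· ≠ x)).reverse, by simpa [Expr.eval] using hτ, ?_⟩
    refine (List.perm_ext_iff_of_nodup ?_ hnd).2 fun y => ?_
    · simpa using hnd.filter _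
    · by_cases hy : y = x <;> simp [hy, hx]

open Classical in
/-- The facts kept after treating the fact `x`. -/
noncomputable def keepStep (F : Set (DenialConstraint D S)) (J : Set (DBFact D S))
    (x : DBFact D S) : Set (DBFact D S) :=
  if Consistent F (insert x J) then insert x J else J

/-- Merges the two kinds of iteration into one, matching one pass through the loop of the program.
-/
theorem run_cons_iff {F : Set (DenialConstraint D S)} {r : DBFact D S → DBFact D S → Prop}
    {A J A' J' : Set (DBFact D S)} {x : DBFact D S} {xs : List (DBFact D S)} :
    Run F r A J (x :: xs) A' J' ↔ x ∈ winnow r A ∧ Run F r (A \ {x}) (keepStep F J x) xs A' J' := by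
  constructor
  · intro h
    cases h with
    | add _ hx hc h => exact ⟨hx, by rwa [keepStep, if_pos hc]⟩
    | discard _ hx hc h => exact ⟨hx, by rwa [keepStep, if_neg hc]⟩
  · rintro ⟨hx, h⟩
    by_cases hc : Consistent F (insert x J)
    · exact .add x hx hc (by rwa [keepStep, if_pos hc] at h)
    · exact .discard x hx hc (by rwa [keepStep, if_neg hc] at h)

theorem ensures_keepCmd (cs : List (DenialConstraint D S)) : ∃ p : Polynomial ℕ,
    ∀ m (σ : ℕ → Val D Rel) N (lJ : List (DBFact D S)) (x : DBFact D S),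
    σ 4 = encodeFacts lJ → σ 5 = x.encode → lJ.length + 1 ≤ N → lJ.Nodup → x ∉ lJ →
    Ensures m (keepCmd cs) σ (p.eval N) (fun τ =>
      ∃ lJ', τ 4 = encodeFacts lJ' ∧ lJ'.Nodup ∧ lJ'.length ≤ lJ.length + 1 ∧
        {y | y ∈ lJ'} = keepStep {c | c ∈ cs} {y | y ∈ lJ} x) := by
  obtain ⟨p, hp⟩ := ensures_checkCmd cs
  refine ⟨p + 14, ?_⟩
  intro m σ N lJ x h4 h5 hN hnd hx
  refine Ensures.assign_seq (T₁ := p.eval N + 9) ?_ (by simp [Expr.cost])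
  refine Ensures.assign_seq (T₁ := p.eval N + 6) ?_ (by simp [Expr.cost])
  refine Ensures.seq_frame (hp m _ (x :: lJ) N ?_ (by simpa using hN) (by simp)) (T₂ := 5) ?_
    (by omega)
  · simp [Expr.eval, h4, h5, encodeFacts, Val.ofList]
  intro τ hτ hfr
  have hset : {y | y ∈ x :: lJ} = insert x {y | y ∈ lJ} := by ext; simp
  have h11 : τ 11 = .nil ↔ Consistent {c | c ∈ cs} (insert x {y | y ∈ lJ}) := by
    rw [← not_iff_not, ← ne_eq, hτ, hset]
    simp [Expr.eval, Consistent]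
  have h12 : τ 12 = encodeFacts (x :: lJ) := by
    rw [hfr 12 fun h => by have := writes_checkCmd h; omega]
    simp [Expr.eval, h4, h5, encodeFacts, Val.ofList]
  have h4' : τ 4 = encodeFacts lJ := by
    rw [hfr 4 fun h => by have := writes_checkCmd h; omega]
    simp [h4]
  refine .ite (T₁ := 2) (fun hb => .assign (by simp [Expr.cost]) ?_)
    (fun hb => .skip (by simp) ?_) (by simp [Test.cost, Expr.cost])
  · exact ⟨x :: lJ, by simp [Expr.eval, h12], by simp [hnd, hx], by simp,
      by rw [keepStep, if_pos (h11.1 hb), hset]⟩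
  · exact ⟨lJ, h4', hnd, by simp, by rw [keepStep, if_neg (mt h11.2 hb)]⟩

end Program

/-! ### Correctness and running time of the whole program -/

section Correctness

variable {D : Type u} {Rel : Type v} {S : Schema Rel}

/-- The registers represent the state of the algorithm with the remaining facts `lA`, the priority
`lr`, the choices `xs` and the facts kept `lJ`. -/
structure Represents (σ : ℕ → Val D Rel) (lA : List (DBFact D S))
    (lr : List (DBFact D S × DBFact D S)) (xs lJ : List (DBFact D S)) : Prop where
  remaining : σ 1 = encodeFacts lA
  pairs : σ 2 = encodePairs lr
  choices : σ 3 = encodeFacts xs.reverse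
  kept : σ 4 = encodeFacts lJ

theorem ensures_stepCmd (cs : List (DenialConstraint D S)) : ∃ p : Polynomial ℕ,
    ∀ m (σ : ℕ → Val D Rel) N (lA : List (DBFact D S)) (lr : List (DBFact D S × DBFact D S))
      (xs lJ : List (DBFact D S)) (x₀ : DBFact D S),
    Represents σ lA lr xs lJ →
    lA.length ≤ N → lr.length ≤ N → (∀ x ∈ lA, (x.encode : Val D Rel).size ≤ N) →
    (∀ p ∈ lr, (p.1.encode : Val D Rel).size ≤ N ∧ (p.2.encode : Val D Rel).size ≤ N) →
    lJ.length + 1 ≤ N → lA.Nodup → lJ.Nodup → (∀ x ∈ lJ, x ∉ lA) →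
    x₀ ∈ winnow (fun x y => (x, y) ∈ lr) {x | x ∈ lA} →
    Ensures m (stepCmd cs) σ (p.eval N) (fun τ =>
      ∃ x ∈ winnow (fun x y => (x, y) ∈ lr) {x | x ∈ lA}, (m = true → x = x₀) ∧
        ∃ lA' lJ', Represents τ lA' lr (xs ++ [x]) lJ' ∧ (x :: lA').Perm lA ∧ lJ'.Nodup ∧
          lJ'.length ≤ lJ.length + 1 ∧
          {y | y ∈ lJ'} = keepStep {c | c ∈ cs} {y | y ∈ lJ} x) := by
  obtain ⟨p, hp⟩ := ensures_pickCmd (D := D) (S := S)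
  obtain ⟨q, hq⟩ := ensures_removeCmd (D := D) (S := S)
  obtain ⟨s, hs⟩ := ensures_keepCmd cs
  refine ⟨p + q + s + 7, ?_⟩
  intro m σ N lA lr xs lJ x₀ hσ hlA hlr hsA hsr hlJ hndA hndJ hdisj hx₀
  refine Ensures.seq_frame (hp m σ N lA lr x₀ hσ.remaining hσ.pairs hlA hlr hsA hsr hx₀)
    (T₂ := q.eval N + s.eval N + 6) ?_ (by simp; omega)
  rintro τ₁ ⟨x, hx, h5, hxm⟩ hfr₁
  have e₁ : ∀ n < 5, τ₁ n = σ n := fun n hn =>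
    hfr₁ n fun h => by have := writes_pickCmd h; omega
  refine Ensures.seq_frame (hq m τ₁ N lA x ((e₁ 1 (by omega)).trans hσ.remaining) h5 hlA hsA
    hx.1 hndA) (T₂ := s.eval N + 5) ?_ (by omega)
  rintro τ₂ ⟨lA', h1, hperm⟩ hfr₂
  have e₂ : ∀ n, n = 2 ∨ n = 3 ∨ n = 4 ∨ n = 5 → τ₂ n = τ₁ n := fun n hn =>
    hfr₂ n fun h => by have := writes_removeCmd h; omega
  refine Ensures.seq_frame (hs m τ₂ N lJ x
    (by rw [e₂ 4 (by omega), e₁ 4 (by omega), hσ.kept]) (by rw [e₂ 5 (by omega), h5]) hlJ hndJ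
    fun h => hdisj x h hx.1) (T₂ := 4) ?_ (by omega)
  rintro τ₃ ⟨lJ', h4, hnd', hlen, hset⟩ hfr₃
  have e₃ : ∀ n, n < 4 ∨ n = 5 → τ₃ n = τ₂ n := fun n hn =>
    hfr₃ n fun h => by have := writes_keepCmd h; omega
  refine .assign (by simp [Expr.cost]) ⟨x, hx, hxm, lA', lJ', ⟨?_, ?_, ?_, ?_⟩, hperm, hnd', hlen,
    hset⟩
  · rw [Function.update_of_ne (by decide), e₃ 1 (by omega), h1]
  · rw [Function.update_of_ne (by decide), e₃ 2 (by omega), e₂ 2 (by omega), e₁ 2 (by omega),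
      hσ.pairs]
  · simp only [Function.update_self, Expr.eval]
    rw [e₃ 5 (by omega), e₂ 5 (by omega), h5, e₃ 3 (by omega), e₂ 3 (by omega), e₁ 3 (by omega),
      hσ.choices]
    simp [encodeFacts, Val.ofList]
  · rw [Function.update_of_ne (by decide), h4]

/-- With favourable choices (`m = true`) the program reports the given execution; with arbitrary
choices it reports some execution. -/
theorem ensures_greedyCmd (cs : List (DenialConstraint D S)) : ∃ p : Polynomial ℕ,
    ∀ m (I : Set (DBFact D S)) r (input : Val D Rel) xs₀ J₀, I.Finite →
    IsPriority I {c | c ∈ cs} r → EncodesInput input I r →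
    (m = true → Execution I {c | c ∈ cs} r xs₀ J₀) →
    Ensures m (greedyCmd cs) (Function.update (fun _ => .nil) 0 input) (p.eval input.size)
      (fun τ => ∃ xs J, Execution I {c | c ∈ cs} r xs J ∧ EncodesOutput (τ 0) xs J ∧
        (m = true → xs = xs₀ ∧ J = J₀)) := by
  obtain ⟨p, hp⟩ := ensures_stepCmd cs
  refine ⟨.X * (p + 3 + 1) + 3 + 1 + (.X * (5 + 8) + 7) + 20, ?_⟩
  rintro m I r _ xs₀ J₀ hI hr ⟨lI, lr, hlI, hlr, rfl⟩ hex
  set N := (Val.cons (encodeFacts lI) (encodePairs lr)).size with hN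
  have hsizes : (encodeFacts lI).size ≤ N ∧ (encodePairs lr).size ≤ N := by
    rw [hN, Val.size]; omega
  have hlenI : lI.length ≤ N := by
    have := Val.length_le_size_ofList (lI.map (DBFact.encode (D := D)))
    rw [List.length_map] at this
    exact this.trans hsizes.1
  have hlenr : lr.length ≤ N := by
    have := Val.length_le_size_ofList
      (lr.map fun p => (.cons p.1.encode p.2.encode : Val D Rel))
    rw [List.length_map] at this
    exact this.trans hsizes.2
  have hsI : ∀ x ∈ lI, (x.encode : Val D Rel).size ≤ N := fun x hx =>
    (Val.size_le_size_ofList (List.mem_map_of_mem hx)).trans hsizes.1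
  have hsr : ∀ p ∈ lr, (p.1.encode : Val D Rel).size ≤ N ∧
      (p.2.encode : Val D Rel).size ≤ N := by
    intro p hp
    have h : (Val.cons p.1.encode p.2.encode : Val D Rel).size ≤ N :=
      (Val.size_le_size_ofList (List.mem_map_of_mem
        (f := fun p : DBFact D S × DBFact D S => (.cons p.1.encode p.2.encode : Val D Rel))
        hp)).trans hsizes.2
    rw [Val.size] at h
    omega
  have hrr : (fun x y => (x, y) ∈ lr) = r := by
    funext x y
    exact propext (hlr.2 (x, y))
  -- The index is the number of remaining facts. The length bounds control the consistency test and
  -- the final reversal; for `m = true`, `ys` is the part of the prescribed execution still to be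
  -- followed.
  let Inv : ℕ → (ℕ → Val D Rel) → Prop := fun n τ =>
    ∃ lA xs lJ, Represents τ lA lr xs lJ ∧ lA.length = n ∧ lA.Nodup ∧ lJ.Nodup ∧
      (∀ x ∈ lA, x ∈ lI) ∧ (∀ x ∈ lJ, x ∉ lA) ∧ lA.length + lJ.length ≤ lI.length ∧
      lA.length + xs.length = lI.length ∧
      Run {c | c ∈ cs} r I ∅ xs {x | x ∈ lA} {x | x ∈ lJ} ∧
      (m = true → ∃ ys, xs₀ = xs ++ ys ∧
        Run {c | c ∈ cs} r {x | x ∈ lA} {x | x ∈ lJ} ys ∅ J₀)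
  have hstep : ∀ n τ, Inv (n + 1) τ →
      (Test.not (.isNil (.reg 1)) : Test D Rel).Holds τ ∧
      (Test.not (.isNil (.reg 1)) : Test D Rel).cost τ ≤ 3 ∧
      Ensures m (stepCmd cs) τ (p.eval N) (Inv n) := by
    rintro n τ ⟨lA, xs, lJ, hrep, hn, hndA, hndJ, hsub, hdisj, hlen, hlen', hrun, hm⟩
    obtain ⟨a, lA₁, hlA⟩ := List.exists_cons_of_length_eq_add_one hn
    refine ⟨by simp [Test.Holds, Expr.eval, hrep.remaining, hlA, encodeFacts, Val.ofList],
      by simp [Test.cost, Expr.cost], ?_⟩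
    have hne : {x | x ∈ lA}.Nonempty := ⟨a, by simp [hlA]⟩
    -- The target is the next prescribed choice for `m = true`, and any undominated fact otherwise.
    have hx₀ : ∃ x₀ ∈ winnow r {x | x ∈ lA}, m = true → ∃ ys, xs₀ = xs ++ x₀ :: ys ∧
        Run {c | c ∈ cs} r ({x | x ∈ lA} \ {x₀}) (keepStep {c | c ∈ cs} {x | x ∈ lJ} x₀) ys ∅
          J₀ := by
      by_cases hmt : m = true
      · obtain ⟨ys, hys, hrun'⟩ := hm hmt
        cases ys with
        | nil =>
          generalize hA : {x | x ∈ lA} = A at hrun' hne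
          cases hrun'
          exact absurd hne Set.not_nonempty_empty
        | cons y ys =>
          rw [run_cons_iff] at hrun'
          exact ⟨y, hrun'.1, fun _ => ⟨ys, hys, hrun'.2⟩⟩
      · obtain ⟨x, hx⟩ := winnow_nonempty hr.acyclic lA.finite_toSet hne
        exact ⟨x, hx, fun h => absurd h hmt⟩
    obtain ⟨x₀, hx₀, hx₀m⟩ := hx₀
    refine (hp m τ N lA lr xs lJ x₀ hrep (by omega) hlenr (fun x hx => hsI x (hsub x hx)) hsr
      (by omega) hndA hndJ hdisj (by rwa [hrr])).mono le_rfl ?_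
    rintro τ' ⟨x, hx, hxm, lA', lJ', hrep', hperm, hndJ', hlenJ, hset⟩
    rw [hrr] at hx
    have hnd' : (x :: lA').Nodup := hperm.nodup_iff.2 hndA
    have hlenA : lA'.length + 1 = lA.length := by simpa using hperm.length_eq
    have hA' : {y | y ∈ lA'} = {y | y ∈ lA} \ {x} := by
      ext y
      simp only [Set.mem_ofPred_eq, Set.mem_sdiff, Set.mem_singleton_iff, ← hperm.mem_iff,
        List.mem_cons]
      constructor
      · exact fun h => ⟨.inr h, fun he => (List.nodup_cons.1 hnd').1 (he ▸ h)⟩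
      · rintro ⟨rfl | h, hne⟩
        · exact absurd rfl hne
        · exact h
    have hmemA : ∀ y, y ∈ lA' ↔ y ∈ lA ∧ y ≠ x := fun y => Set.ext_iff.1 hA' y
    refine ⟨lA', xs ++ [x], lJ', hrep', by omega, (List.nodup_cons.1 hnd').2, hndJ',
      fun y hy => hsub y ((hmemA y).1 hy).1, fun y hy hyA => ?_, by omega,
      by rw [List.length_append, List.length_singleton]; omega, hrun.trans ?_, fun hmt => ?_⟩
    · have hy' : y ∈ keepStep {c | c ∈ cs} {y | y ∈ lJ} x := hset ▸ hy
      rw [keepStep] at hy'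
      split_ifs at hy'
      · rcases hy' with rfl | hy'
        · exact ((hmemA y).1 hyA).2 rfl
        · exact hdisj y hy' ((hmemA y).1 hyA).1
      · exact hdisj y hy' ((hmemA y).1 hyA).1
    · rw [run_cons_iff, hA', hset]
      exact ⟨hx, .refl _ _⟩
    · obtain ⟨ys, hys, hrun'⟩ := hx₀m hmt
      obtain rfl := hxm hmt
      exact ⟨ys, by simpa using hys, by rwa [hA', hset]⟩
  have hzero : ∀ τ, Inv 0 τ → ¬ (Test.not (.isNil (.reg 1)) : Test D Rel).Holds τ ∧
      (Test.not (.isNil (.reg 1)) : Test D Rel).cost τ ≤ 3 := by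
    rintro τ ⟨lA, xs, lJ, hrep, hn, -⟩
    obtain rfl := List.length_eq_zero_iff.1 hn
    exact ⟨by simp [Test.Holds, Expr.eval, hrep.remaining, encodeFacts, Val.ofList],
      by simp [Test.cost, Expr.cost]⟩
  refine Ensures.assign_seq
    (T₁ := N * (p.eval N + 3 + 1) + 3 + 1 + (N * (5 + 8) + 7) + 16) ?_ (by simp [Expr.cost])
  refine Ensures.assign_seq
    (T₁ := N * (p.eval N + 3 + 1) + 3 + 1 + (N * (5 + 8) + 7) + 12) ?_ (by simp [Expr.cost])
  refine Ensures.seq ((Ensures.loop hstep hzero (n := lI.length) ?_).mono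
    (T := N * (p.eval N + 3 + 1) + 3 + 1) (by gcongr) fun τ hτ => hτ)
    (T₂ := (N * (5 + 8) + 7) + 11) ?_ (by omega)
  · have hIset : {x | x ∈ lI} = I := Set.ext hlI.2
    refine ⟨lI, [], [], ⟨?_, ?_, ?_, ?_⟩, rfl, hlI.1, List.nodup_nil, fun x hx => hx, by simp,
      by simp, by simp, ?_, fun hmt => ⟨xs₀, rfl, ?_⟩⟩
    · simp [Expr.eval]
    · simp [Expr.eval]
    · simp [encodeFacts, Val.ofList]
    · simp [encodeFacts, Val.ofList]
    · simpa [hIset] using Run.refl I ∅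
    · simpa [hIset] using (hex hmt).run hI hr.acyclic
  rintro τ ⟨lA, xs, lJ, hrep, hn, -, hndJ, -, -, -, hlen', hrun, hm⟩
  obtain rfl := List.length_eq_zero_iff.1 hn
  refine Ensures.assign_seq (T₁ := (N * (5 + 8) + 7) + 8) ?_ (by simp [Expr.cost])
  -- Choices are stored last first, so they are reversed before being reported.
  refine Ensures.seq_frame (Ensures.forEach (N := N) (T := 5) (l := xs.reverse)
    (enc := DBFact.encode) (Inv := fun pre τ => τ 10 = encodeFacts pre.reverse)
    (by simpa [Expr.eval, encodeFacts] using hrep.choices)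
    (by simp only [List.length_reverse, List.length_nil] at hlen' ⊢; omega)
    (by simp [Cmd.Writes]) ?_ ?_) (T₂ := 4) ?_ (by simp [Expr.cost])
  · simp [Expr.eval, encodeFacts, Val.ofList]
  · intro pre a post τ' hl hτ6 hfr hinv
    refine .assign (by simp [Expr.cost]) ?_
    simp [Expr.eval, hinv, hτ6, encodeFacts, Val.ofList]
  · intro τ' hτ' hfr
    have h4 : τ' 4 = encodeFacts lJ := by
      rw [hfr 4 (by simp [Cmd.writes_forEach, Cmd.Writes]), Function.update_of_ne (by decide),
        hrep.kept]
    refine .assign (by simp [Expr.cost]) ⟨xs, {x | x ∈ lJ}, ⟨_, hrun, by simp [winnow]⟩,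
      ⟨lJ, ⟨hndJ, fun x => Iff.rfl⟩, ?_⟩, fun hmt => ?_⟩
    · simp [Expr.eval, hτ', h4]
    · obtain ⟨ys, hys, hrun'⟩ := hm hmt
      -- With no facts left, the rest of the prescribed execution is empty, so the output is the
      -- prescribed one.
      cases ys with
      | nil =>
        refine ⟨by simpa using hys.symm, ?_⟩
        generalize {x | x ∈ lJ} = J at hrun'
        generalize {x : DBFact D S | x ∈ []} = A at hrun'
        cases hrun'
        rfl
      | cons y ys => exact absurd (run_cons_iff.1 hrun').1.1 (by simp)

theorem implements_greedyCmd (cs : List (DenialConstraint D S)) :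
    Implements (greedyCmd cs) {c | c ∈ cs} := by
  obtain ⟨p, hp⟩ := ensures_greedyCmd cs
  intro I r input hI hr hin
  refine ⟨fun out hout => ?_, fun xs J hex => ?_⟩
  · refine Ensures.of_returns (R := fun v => ∃ xs J, Execution I {c | c ∈ cs} r xs J ∧
      EncodesOutput v xs J) ((hp false I r input [] ∅ hI hr hin (by simp)).mono le_rfl ?_) hout
    rintro τ ⟨xs, J, h1, h2, -⟩
    exact ⟨xs, J, h1, h2⟩
  · obtain ⟨τ, ⟨xs', J', -, h2, h3⟩, h4⟩ :=
      (hp true I r input xs J hI hr hin fun _ => hex).exists_returns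
    obtain ⟨rfl, rfl⟩ := h3 rfl
    exact ⟨τ 0, h4, h2⟩

theorem polyTime_greedyCmd (cs : List (DenialConstraint D S)) :
    PolyTime (greedyCmd cs) {c | c ∈ cs} := by
  obtain ⟨p, hp⟩ := ensures_greedyCmd cs
  exact ⟨p, fun I r input hI hr hin =>
    (hp false I r input [] ∅ hI hr hin (by simp)).haltsWithin⟩

end Correctness

end PrefRepair

theorem mainTheorem5 {D Rel : Type*} (S : Schema Rel) (F : Set (DenialConstraint D S)) :
    (∀ (I : Set (DBFact D S)) (r : DBFact D S → DBFact D S → Prop), I.Finite → IsPriority I F r →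
      -- soundness and completeness
      {J | ∃ xs, Execution I F r xs J} = CRep I F r ∧
      -- termination: no run of the main loop makes more than `|I|` iterations
      ∀ xs A J, Run F r I ∅ xs A J → xs.length ≤ I.ncard) ∧
    -- polynomial running time
    (F.Finite → ∃ P : Cmd D Rel, Implements P F ∧ PolyTime P F) := by
  refine ⟨fun I r hI hr => ⟨outputs_eq_cRep hI hr, fun xs A J h => h.length_le hI⟩, fun hF => ?_⟩
  obtain ⟨cs, rfl⟩ : ∃ cs : List (DenialConstraint D S), {c | c ∈ cs} = F :=
    ⟨hF.toFinset.toList, by ext c; simp⟩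
  exact ⟨greedyCmd cs, implements_greedyCmd cs, polyTime_greedyCmd cs⟩
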